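/- An automorphism of a standard Borel probability space $(X,\mathcal B,\mu)$ is an invertible bi-measurable $\mu$-preserving map $T\colon X\to X$; its Koopman operator is the unitary operator $U_Tf=f\circ T$ on $L^2(X,\mu;\mathbb C)$. For a unitary operator $U$ on a separable Hilbert space $H$ and $x\in H$, the spectral measure $\sigma_x$ is the finite positive Borel measure on $\mathbb T=\{z\in\mathbb C:|z|=1\}$ with $\langle U^mx,x\rangle=\int_{\mathbb T}z^m\,d\sigma_x(z)$ for all $m\in\mathbb Z$, and $\mathbb Z(x)$ is the closed linear span of $\{U^mx:m\in\mathbb Z\}$. The maximal spectral type of $U$ is the class of all finite measures equivalent to $\sigma_{x_1}$ in any orthogonal decomposition $H=\bigoplus_{i\ge 1}\mathbb Z(x_i)$ with $\sigma_{x_1}\gg\sigma_{x_2}\gg\cdots$; the maximal spectral type $\sigma_T$ of $T$ is that of $U_T$. The automorphism $T$ has the property $\mathrm{CS}(n)$ if $\sigma_T\perp\nu_1*\cdots*\nu_n$ for all continuous (i.e. atomless) finite positive Borel measures $\nu_1,\dots,\nu_n$ on $\mathbb T$. An ergodic joining of automorphisms $T$ of $(X,\mu)$ and $S$ of $(Y,\nu)$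 is a $T\times S$-invariant ergodic probability measure on $X\times Y$ with marginals $\mu$ and $\nu$. For $m\ge 1$, an ergodic automorphism $T$ of $(X,\mathcal B,\mu)$ has the joining primeness property $\mathrm{JP}(m)$ if for every $k\ge m+1$, all weakly mixing automorphisms $S_i$ of standard Borel probability spaces $(Y_i,\mathcal C_i,\nu_i)$, $1\le i\le k$, and every ergodic joining $\lambda$ of $T$ and $S_1\times\cdots\times S_k$, there are indices $1\le i_1<\cdots<i_m\le k$ such that $$\lambda=\lambda_{X,Y_{i_1},\dots,Y_{i_m}}\otimes\bigotimes_{j\notin\{i_1,\dots,i_m\}}\nu_j,$$ where $\lambda_{X,Y_{i_1},\dots,Y_{i_m}}$ is the projection of $\lambda$ on $X\times Y_{i_1}\times\cdots\times Y_{i_m}$. Theorem. Let $n\ge 2$ and let $T$ be an ergodic automorphism of a standard Borel probability space $(X,\mathcal B,\mu)$ with the property $\mathrm{CS}(n)$. Then $T$ has the property $\mathrm{JP}(n-1)$. -/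

import Mathlib

open MeasureTheory Filter
open scoped Topology

universe u v

noncomputable section

/-- The circle `{z : ℂ | |z| = 1}` carries its Borel σ-algebra. -/
instance instMeasurableSpaceCircle : MeasurableSpace Circle := borel Circle

instance instBorelSpaceCircle : BorelSpace Circle := ⟨rfl⟩

/-! ### Spectral theory of unitary operators -/

section Spectral

variable {H : Type*} [NormedAddCommGroup H] [InnerProductSpace ℂ H]

/-- `σ` is the spectral measure of `x` with respect to the unitary operator `U`: the finite
positive Borel measure on the circle with `⟨Uⁿ x, x⟩ = ∫ zⁿ dσ` for all `n ∈ ℤ`. (Mathlib's inner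
product is linear in the second variable.) -/
def IsSpectralMeasure (U : H ≃ₗᵢ[ℂ] H) (x : H) (σ : Measure Circle) : Prop :=
  IsFiniteMeasure σ ∧ ∀ n : ℤ, inner ℂ x ((U ^ n) x) = ∫ z : Circle, ((z ^ n : Circle) : ℂ) ∂σ

/-- The cyclic space of `x`: the closed linear span of `Uⁿ x`, `n ∈ ℤ`. -/
def cyclicSpace (U : H ≃ₗᵢ[ℂ] H) (x : H) : Submodule ℂ H :=
  (Submodule.span ℂ (Set.range fun n : ℤ => (U ^ n) x)).topologicalClosure

/-- `σ` is (a representative of) the maximal spectral type of `U`: there is a decomposition of `H`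
into an orthogonal Hilbert sum of cyclic spaces of vectors `x 0, x 1, …` whose spectral measures
`τ 0 ≫ τ 1 ≫ …` decrease with respect to absolute continuity, and `σ` is a finite measure
equivalent to `τ 0`. (Some of the `x i` may be zero.) -/
def IsMaximalSpectralType [CompleteSpace H] (U : H ≃ₗᵢ[ℂ] H) (σ : Measure Circle) : Prop :=
  IsFiniteMeasure σ ∧
  ∃ (x : ℕ → H) (τ : ℕ → Measure Circle),
    IsHilbertSum ℂ (fun i => cyclicSpace U (x i)) (fun i => (cyclicSpace U (x i)).subtypeₗᵢ) ∧
    (∀ i, IsSpectralMeasure U (x i) (τ i)) ∧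
    (∀ i, τ (i + 1) ≪ τ i) ∧
    σ ≪ τ 0 ∧ τ 0 ≪ σ

end Spectral

/-- The convolution `ν₁ ∗ ⋯ ∗ νₙ` of finite measures on the circle: the image of the product measure
under multiplication. -/
def circleConvolution {n : ℕ} (ν : Fin n → Measure Circle) [∀ i, IsFiniteMeasure (ν i)] :
    Measure Circle :=
  (Measure.pi ν).map fun z => ∏ i, z i

/-- Convolution singularity of order `n` for a measure on the circle: singularity with respect to
the convolution of any `n` continuous (that is, atomless) finite measures. -/
def MeasureHasCS (n : ℕ) (σ : Measure Circle) : Prop :=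
  ∀ (ν : Fin n → Measure Circle) [∀ i, IsFiniteMeasure (ν i)] [∀ i, NullSingletonClass (ν i)],
    Measure.MutuallySingular σ (circleConvolution ν)

/-! ### Automorphisms of probability spaces -/

section Dynamics

variable {X : Type*} [MeasurableSpace X]

/-- The Koopman operator `f ↦ f ∘ T` of an automorphism, a unitary operator on `L²(X, μ; ℂ)`. -/
def koopman (μ : Measure X) (T : X ≃ᵐ X) (hT : MeasurePreserving T μ μ) :
    Lp ℂ 2 μ ≃ₗᵢ[ℂ] Lp ℂ 2 μ where
  toFun f := Lp.compMeasurePreserving T hT f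
  invFun f := Lp.compMeasurePreserving T.symm (hT.symm T) f
  map_add' f g := map_add _ f g
  map_smul' c f := (Lp.compMeasurePreservingₗ ℂ T hT).map_smul c f
  left_inv f := by
    beta_reduce
    rw [← Lp.compMeasurePreserving_comp_apply]
    simp
  right_inv f := by
    beta_reduce
    rw [← Lp.compMeasurePreserving_comp_apply]
    simp
  norm_map' f := Lp.norm_compMeasurePreserving f hT

/-- The automorphism `T` has the convolution singularity property of order `n`: its maximal spectral
type, that is, the maximal spectral type of its Koopman operator on `L²(X, μ)`, has it. -/
def HasCS (n : ℕ) (μ : Measure X) (T : X ≃ᵐ X) (hT : MeasurePreserving T μ μ) : Prop :=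
  ∃ σ : Measure Circle, IsMaximalSpectralType (koopman μ T hT) σ ∧ MeasureHasCS n σ

/-- `S` is a weakly mixing automorphism of the probability space `(X, μ)`:
`N⁻¹ ∑_{i < N} |μ (S⁻ⁱ A ∩ B) - μ A * μ B| → 0` for all measurable `A`, `B`. -/
def IsWeaklyMixing (μ : Measure X) (S : X ≃ᵐ X) : Prop :=
  MeasurePreserving S μ μ ∧
  ∀ A B : Set X, MeasurableSet A → MeasurableSet B →
    Tendsto (fun N : ℕ => (N : ℝ)⁻¹ *
      ∑ i ∈ Finset.range N, |μ.real (S^[i] ⁻¹' A ∩ B) - μ.real A * μ.real B|) atTop (𝓝 0)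

/-- `lam` is an ergodic joining of `T` (acting on `(X, μ)`) and `S` (acting on `(Y, ν)`): a measure
on `X × Y` with marginals `μ` and `ν`, invariant and ergodic under `T × S`. -/
def IsErgodicJoining {Y : Type*} [MeasurableSpace Y] (μ : Measure X) (T : X ≃ᵐ X)
    (ν : Measure Y) (S : Y ≃ᵐ Y) (lam : Measure (X × Y)) : Prop :=
  lam.map Prod.fst = μ ∧ lam.map Prod.snd = ν ∧ Ergodic (T.prodCongr S) lam

end Dynamics

/-- The joining primeness property of order `n`: for all `k ≥ n + 1`, all weakly mixing automorphisms
`S₁, …, S_k` of standard Borel probability spaces `(Yᵢ, νᵢ)` and every ergodic joining `lam` of `T`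
with `S₁ × ⋯ × S_k` there is a set `I` of `n` indices such that `lam` is the product of its projection
on `X × ∏_{i ∈ I} Yᵢ` and of `⨂_{j ∉ I} νⱼ`. Here `X × ∏ᵢ Yᵢ` is identified with
`(X × ∏_{i ∈ I} Yᵢ) × ∏_{j ∉ I} Yⱼ` by rearranging the coordinates. -/
def HasJP {X : Type u} [MeasurableSpace X] (n : ℕ) (μ : Measure X) (T : X ≃ᵐ X) : Prop :=
  ∀ (k : ℕ), n + 1 ≤ k → ∀ (Y : Fin k → Type v) [∀ i, MeasurableSpace (Y i)]
    [∀ i, StandardBorelSpace (Y i)] (ν : ∀ i, Measure (Y i)) [∀ i, IsProbabilityMeasure (ν i)]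
    (S : ∀ i, Y i ≃ᵐ Y i), (∀ i, IsWeaklyMixing (ν i) (S i)) →
    ∀ lam : Measure (X × (∀ i, Y i)),
      IsErgodicJoining μ T (Measure.pi ν) (MeasurableEquiv.piCongrRight S) lam →
      ∃ I : Finset (Fin k), I.card = n ∧
        lam.map (fun p => ((p.1, fun i : {i // i ∈ I} => p.2 i), fun j : {j // j ∉ I} => p.2 j)) =
          (lam.map fun p => (p.1, fun i : {i // i ∈ I} => p.2 i)).prod
            (Measure.pi fun j : {j // j ∉ I} => ν j)

end

set_option linter.unusedSectionVars false

noncomputable section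

/-! ### Continuous functional calculus of a unitary operator on the circle -/

section Calculus

/-! Let λ be an ergodic joining of T with S₁ × ⋯ × S_k. Consider a product of centered indicators of
at least n different coordinates yᵢ. Since the Y-marginal of λ is a product measure, the
autocorrelations of this function under λ are the products of those of its factors, so its spectral
measure is a convolution. Weak mixing and Wiener's lemma make each factor atomless, and after
grouping the factors the spectral measure is a convolution of exactly n atomless measures. By CS(n)
it is singular to the spectral type of T. Vectors with mutually singular spectral measures are
orthogonal, so the product is orthogonal to L²(X) inside L²(λ)
(`HasCS.integral_indicator_mul_prod_eq_zero`).

Now write every indicator of a side of a box as centered part plus constant and expand. Only the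
terms with fewer than n centered factors survive. Expanding these back into indicators exhibits λ as
a signed combination of the measures λ_J = `decouple lam ν J` with |J| < n, in which the coordinates
outside J are resampled independently (`measureReal_eq_sum_decouple`). Hence λ cannot be singular to
every such λ_J.

Each λ_J is ergodic for the same map, being a factor of the product of the system on λ with weakly
mixing ones (`ergodic_decouple`). Two ergodic measures are equal or mutually singular
(`Ergodic.eq_or_mutuallySingular`), so λ = λ_J for some J with at most n - 1 elements. Enlarging J
to exactly n - 1 indices gives the required product form. -/

/-- The Laurent monomial `z ↦ zⁿ` as a continuous function on the circle. -/
def circleMonomial (n : ℤ) : C(Circle, ℂ) where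
  toFun z := ((z ^ n : Circle) : ℂ)
  continuous_toFun := continuous_subtype_val.comp (continuous_zpow n)

theorem circleMonomial_apply (n : ℤ) (z : Circle) :
    circleMonomial n z = ((z ^ n : Circle) : ℂ) := rfl

theorem circleMonomial_add (m n : ℤ) :
    circleMonomial (m + n) = circleMonomial m * circleMonomial n := by
  ext z
  simp only [circleMonomial_apply, zpow_add, ContinuousMap.mul_apply, Circle.coe_mul]

theorem circleMonomial_zero : circleMonomial 0 = 1 := by
  ext z
  simp [circleMonomial_apply]

theorem star_circleMonomial (n : ℤ) : star (circleMonomial n) = circleMonomial (-n) := by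
  ext z
  simp only [circleMonomial_apply, ContinuousMap.star_apply, zpow_neg]
  rw [Circle.coe_inv_eq_conj]
  rfl

/-- The star subalgebra of Laurent polynomials in `C(Circle, ℂ)`. -/
def laurentSubalgebra : StarSubalgebra ℂ C(Circle, ℂ) where
  toSubalgebra := Algebra.adjoin ℂ (Set.range circleMonomial)
  star_mem' := by
    change Algebra.adjoin ℂ (Set.range circleMonomial) ≤
      star (Algebra.adjoin ℂ (Set.range circleMonomial))
    refine Algebra.adjoin_le ?_
    rintro - ⟨n, rfl⟩
    exact Algebra.subset_adjoin ⟨-n, (star_circleMonomial n).symm⟩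

theorem laurentSubalgebra_toSubmodule :
    Subalgebra.toSubmodule laurentSubalgebra.toSubalgebra =
      Submodule.span ℂ (Set.range circleMonomial) := by
  apply Algebra.adjoin_eq_span_of_subset
  refine Set.Subset.trans ?_ Submodule.subset_span
  intro x hx
  refine Submonoid.closure_induction (fun _ => id) ⟨0, circleMonomial_zero⟩ ?_ hx
  rintro - - - - ⟨m, rfl⟩ ⟨n, rfl⟩
  exact ⟨m + n, circleMonomial_add m n⟩

/-- Laurent polynomials are dense in the continuous functions on the circle. -/
theorem span_circleMonomial_closure_eq_top :
    (Submodule.span ℂ (Set.range circleMonomial)).topologicalClosure = ⊤ := by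
  rw [← laurentSubalgebra_toSubmodule]
  refine congr_arg (Subalgebra.toSubmodule <| StarSubalgebra.toSubalgebra ·)
    (ContinuousMap.starSubalgebra_topologicalClosure_eq_top_of_separatesPoints
      laurentSubalgebra ?_)
  intro x y hxy
  -- The coordinate function z ↦ z already separates points.
  refine ⟨_, ⟨circleMonomial 1, Algebra.subset_adjoin ⟨1, rfl⟩, rfl⟩, ?_⟩
  intro h
  exact hxy (Circle.ext (by simpa [circleMonomial_apply] using h))

variable {H : Type*} [NormedAddCommGroup H] [InnerProductSpace ℂ H] [CompleteSpace H]

/-- A linear isometric automorphism, seen as a bounded operator, is a unitary element. -/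
theorem coe_mem_unitary (U : H ≃ₗᵢ[ℂ] H) : (U : H →L[ℂ] H) ∈ unitary (H →L[ℂ] H) :=
  (Unitary.linearIsometryEquiv.symm U).2

theorem isStarNormal_coe (U : H ≃ₗᵢ[ℂ] H) : IsStarNormal (U : H →L[ℂ] H) :=
  ⟨((Unitary.mem_iff.1 (coe_mem_unitary U)).1.trans
    (Unitary.mem_iff.1 (coe_mem_unitary U)).2.symm)⟩

/-- The inclusion of the spectrum of a unitary operator in the circle. -/
def spectrumToCircle (U : H ≃ₗᵢ[ℂ] H) : C(spectrum ℂ (U : H →L[ℂ] H), Circle) where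
  toFun z := ⟨z, spectrum.subset_circle_of_unitary (coe_mem_unitary U) z.2⟩
  continuous_toFun := Continuous.subtype_mk continuous_subtype_val _

/-- The continuous functional calculus `φ ↦ φ(U)` of a unitary operator `U`. -/
def circleCalculus (U : H ≃ₗᵢ[ℂ] H) : C(Circle, ℂ) →⋆ₐ[ℂ] (H →L[ℂ] H) :=
  (cfcHom (isStarNormal_coe U)).comp
    (ContinuousMap.compStarAlgHom' ℂ ℂ (spectrumToCircle U))

theorem continuous_circleCalculus (U : H ≃ₗᵢ[ℂ] H) : Continuous (circleCalculus U) :=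
  (cfcHom_continuous (isStarNormal_coe U)).comp (ContinuousMap.continuous_precomp _)

theorem circleCalculus_one (U : H ≃ₗᵢ[ℂ] H) :
    circleCalculus U (circleMonomial 1) = (U : H →L[ℂ] H) := by
  have h := cfcHom_id (R := ℂ) (isStarNormal_coe U)
  refine Eq.trans ?_ h
  change cfcHom _ _ = cfcHom _ _
  congr 1
  ext z
  exact congrArg Subtype.val (zpow_one (spectrumToCircle U z))

theorem circleCalculus_monomial (U : H ≃ₗᵢ[ℂ] H) (n : ℤ) (x : H) :
    circleCalculus U (circleMonomial n) x = (U ^ n) x := by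
  have hneg : ∀ y, circleCalculus U (circleMonomial (-1)) y = U⁻¹ y := by
    intro y
    have h1 : circleCalculus U (circleMonomial (-1)) * circleCalculus U (circleMonomial 1) = 1 := by
      rw [← map_mul, ← circleMonomial_add, neg_add_cancel, circleMonomial_zero, map_one]
    have h2 := DFunLike.congr_fun h1 (U⁻¹ y)
    rw [circleCalculus_one] at h2
    have h3 : U (U⁻¹ y) = y := U.apply_symm_apply y
    simpa [h3] using h2
  induction n using Int.induction_on generalizing x with
  | zero => simp [circleMonomial_zero]
  | succ i ih =>
    rw [circleMonomial_add, map_mul, zpow_add, zpow_one]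
    rw [mul_apply_eq_comp, circleCalculus_one, ih]
    rfl
  | pred i ih =>
    rw [sub_eq_add_neg, circleMonomial_add, map_mul, zpow_add, zpow_neg_one]
    rw [mul_apply_eq_comp, hneg, ih]
    rfl

/-- Both sides are continuous and linear in `φ`, and they agree on monomials by definition of the
spectral measure; Laurent polynomials are dense. -/
theorem IsSpectralMeasure.inner_circleCalculus {U : H ≃ₗᵢ[ℂ] H} {x : H} {σ : Measure Circle}
    (h : IsSpectralMeasure U x σ) (φ : C(Circle, ℂ)) :
    inner ℂ x (circleCalculus U φ x) = ∫ z, φ z ∂σ := by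
  have := h.1
  have hφ : φ ∈ (Submodule.span ℂ (Set.range circleMonomial)).topologicalClosure := by
    rw [span_circleMonomial_closure_eq_top]; trivial
  have hint : ∀ ψ : C(Circle, ℂ), Integrable ψ σ := fun ψ =>
    ψ.continuous.integrable_of_hasCompactSupport (HasCompactSupport.of_compactSpace _)
  have hcont : Continuous fun ψ : C(Circle, ℂ) => ∫ z, ψ z ∂σ := by
    refine Continuous.congr
      ((L1.continuous_integral (E := ℂ)).comp (ContinuousMap.toLp 1 σ ℂ).continuous) fun ψ => ?_
    change L1.integral _ = _
    rw [L1.integral_eq_integral]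
    exact integral_congr_ae (ContinuousMap.coeFn_toLp σ ψ)
  refine closure_minimal (t := {ψ : C(Circle, ℂ) |
    inner ℂ x (circleCalculus U ψ x) = ∫ z, ψ z ∂σ}) ?_ (isClosed_eq ?_ hcont) hφ
  · intro ψ hψ
    refine Submodule.span_induction ?_ ?_ ?_ ?_ hψ
    · rintro - ⟨n, rfl⟩
      exact (congrArg _ (circleCalculus_monomial U n x)).trans (h.2 n)
    · simp
    · intro f g _ _ hf hg
      simp only [Set.mem_ofPred_eq] at hf hg ⊢
      rw [map_add, add_apply, inner_add_right, hf, hg,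
        ← integral_add (hint f) (hint g)]
      rfl
    · intro a f _ hf
      simp only [Set.mem_ofPred_eq] at hf ⊢
      rw [map_smul, smul_apply, inner_smul_right, hf, ← smul_eq_mul,
        ← integral_smul]
      rfl
  · have h1 : Continuous fun ψ : C(Circle, ℂ) => circleCalculus U ψ x :=
      (ContinuousLinearMap.apply ℂ H x).continuous.comp (continuous_circleCalculus U)
    exact continuous_const.inner h1

/-- The calculus is multiplicative and respects adjoints, so the identity for inner products applies
to `star φ * φ`. This makes φ ↦ φ(U)x isometric for the L²(σ) norm. -/
theorem IsSpectralMeasure.norm_sq_circleCalculus {U : H ≃ₗᵢ[ℂ] H} {x : H} {σ : Measure Circle}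
    (h : IsSpectralMeasure U x σ) (φ : C(Circle, ℂ)) :
    ‖circleCalculus U φ x‖ ^ 2 = ∫ z, ‖φ z‖ ^ 2 ∂σ := by
  have h1 := h.inner_circleCalculus (star φ * φ)
  rw [map_mul, map_star, mul_apply_eq_comp, ContinuousLinearMap.star_eq_adjoint,
    ContinuousLinearMap.adjoint_inner_right, inner_self_eq_norm_sq_to_K] at h1
  have h2 : ∀ z, (star φ * φ) z = ((‖φ z‖ ^ 2 : ℝ) : ℂ) := fun z => by
    simp [ContinuousMap.mul_apply, ← Complex.conj_mul']
  simp_rw [h2] at h1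
  rw [integral_complex_ofReal] at h1
  exact Complex.ofReal_injective ((Complex.ofReal_pow _ _).trans h1)

/-- Vectors with mutually singular spectral measures are orthogonal. -/
theorem IsSpectralMeasure.inner_eq_zero {U : H ≃ₗᵢ[ℂ] H} {a b : H} {α β : Measure Circle}
    (ha : IsSpectralMeasure U a α) (hb : IsSpectralMeasure U b β)
    (h : α.MutuallySingular β) : inner ℂ a b = 0 := by
  have := ha.1
  have := hb.1
  obtain ⟨s, hs, hαs, hβs⟩ := h
  have key : ∀ ε : ℝ, 0 < ε → ‖inner ℂ a b‖ ≤ ε * (‖a‖ + ‖b‖) := by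
    intro ε hε
    -- Approximate the indicator of `s` by a continuous `φ` in L²(α + β). As `s` is null for α and
    -- conull for β, both φ(U)a and (1 - φ)(U)b are then small.
    have hmem : MemLp (s.indicator fun _ => (1 : ℂ)) 2 (α + β) :=
      memLp_indicator_const _ hs _ (Or.inr (measure_ne_top _ _))
    obtain ⟨g, hg, hgm⟩ := hmem.exists_boundedContinuous_eLpNorm_sub_le (by simp)
      (ε := ENNReal.ofReal ε) (by simpa using hε)
    let φ : C(Circle, ℂ) := g.toContinuousMap
    have hle : ∀ (τ : Measure Circle) (ψ : C(Circle, ℂ)) (_ : IsFiniteMeasure τ),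
        eLpNorm ψ 2 τ ≤ ENNReal.ofReal ε → ∫ z, ‖ψ z‖ ^ 2 ∂τ ≤ ε ^ 2 := by
      intro τ ψ _ h
      have hψ : MemLp ψ 2 τ := ⟨ψ.continuous.aestronglyMeasurable, h.trans_lt ENNReal.ofReal_lt_top⟩
      rw [hψ.eLpNorm_eq_integral_rpow_norm (by simp) (by simp)] at h
      rw [ENNReal.ofReal_le_ofReal_iff hε.le] at h
      have h0 : 0 ≤ ∫ z, ‖ψ z‖ ^ 2 ∂τ := integral_nonneg fun _ => by positivity
      simp only [ENNReal.toReal_ofNat, Real.rpow_ofNat] at h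
      rw [← one_div, ← Real.sqrt_eq_rpow] at h
      exact (Real.sqrt_le_left hε.le).1 h
    have hα : ∫ z, ‖φ z‖ ^ 2 ∂α ≤ ε ^ 2 := by
      refine hle α φ inferInstance ?_
      refine le_trans ?_ ((eLpNorm_mono_measure _ (Measure.le_add_right le_rfl)).trans hg)
      refine (eLpNorm_congr_norm_ae ?_).le
      filter_upwards [measure_eq_zero_iff_ae_notMem.1 hαs] with z hz
      simp [hz, φ]
    have hβ : ∫ z, ‖(1 - φ) z‖ ^ 2 ∂β ≤ ε ^ 2 := by
      refine hle β (1 - φ) inferInstance ?_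
      refine le_trans ?_ ((eLpNorm_mono_measure _ (Measure.le_add_left le_rfl)).trans hg)
      refine (eLpNorm_congr_norm_ae ?_).le
      filter_upwards [measure_eq_zero_iff_ae_notMem.1 hβs] with z hz
      have hz : z ∈ s := by simpa using hz
      simp [hz, φ]
    rw [← ha.norm_sq_circleCalculus] at hα
    rw [← hb.norm_sq_circleCalculus] at hβ
    -- Split b = φ(U)b + (1 - φ)(U)b and move φ(U) onto `a` as its adjoint.
    have hsplit : inner ℂ a b = inner ℂ (circleCalculus U (star φ) a) b
        + inner ℂ a (circleCalculus U (1 - φ) b) := by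
      rw [map_star, ContinuousLinearMap.star_eq_adjoint, ContinuousLinearMap.adjoint_inner_left,
        ← inner_add_right]
      simp
    have hstar : ‖circleCalculus U (star φ) a‖ ^ 2 = ‖circleCalculus U φ a‖ ^ 2 := by
      rw [ha.norm_sq_circleCalculus, ha.norm_sq_circleCalculus]
      simp
    have hα' : ‖circleCalculus U (star φ) a‖ ≤ ε := by
      refine (abs_le_of_sq_le_sq' (hstar.le.trans hα) hε.le).2
    rw [hsplit]
    refine (norm_add_le _ _).trans ?_
    have e1 := norm_inner_le_norm (𝕜 := ℂ) (circleCalculus U (star φ) a) b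
    have e2 := norm_inner_le_norm (𝕜 := ℂ) a (circleCalculus U (1 - φ) b)
    have e3 : ‖circleCalculus U (1 - φ) b‖ ≤ ε := (abs_le_of_sq_le_sq' hβ hε.le).2
    nlinarith [norm_nonneg a, norm_nonneg b]
  rw [← norm_eq_zero]
  refine le_antisymm ?_ (norm_nonneg _)
  have hlim : Tendsto (fun ε : ℝ => ε * (‖a‖ + ‖b‖)) (𝓝[>] 0) (𝓝 0) := by
    have : Tendsto (fun ε : ℝ => ε * (‖a‖ + ‖b‖)) (𝓝 0) (𝓝 (0 * (‖a‖ + ‖b‖))) :=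
      tendsto_id.mul_const _
    rw [zero_mul] at this
    exact this.mono_left nhdsWithin_le_nhds
  exact ge_of_tendsto hlim (by filter_upwards [self_mem_nhdsWithin] with ε hε using key ε hε)

/-- Continuous real functions on the circle, as complex ones. -/
def circleOfReal : C(Circle, ℝ) →ₗ[ℝ] C(Circle, ℂ) where
  toFun f := ⟨fun z => (f z : ℂ), Complex.continuous_ofReal.comp f.continuous⟩
  map_add' f g := by ext; simp
  map_smul' c f := by ext; simp

theorem circleOfReal_apply (f : C(Circle, ℝ)) (z : Circle) : circleOfReal f z = f z := rfl

/-- The positive functional `f ↦ ⟨x, f(U) x⟩` on real continuous functions on the circle. -/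
def spectralFunctional (U : H ≃ₗᵢ[ℂ] H) (x : H) :
    CompactlySupportedContinuousMap Circle ℝ →ₚ[ℝ] ℝ :=
  PositiveLinearMap.mk₀
    { toFun := fun f => (inner ℂ x (circleCalculus U (circleOfReal f.toContinuousMap) x)).re
      map_add' := fun f g => by
        have : (f + g).toContinuousMap = f.toContinuousMap + g.toContinuousMap := rfl
        rw [this, map_add, map_add, add_apply, inner_add_right, Complex.add_re]
      map_smul' := fun c f => by
        have : (c • f).toContinuousMap = c • f.toContinuousMap := rfl
        rw [this, map_smul, show c • circleOfReal f.toContinuousMap =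
          (c : ℂ) • circleOfReal f.toContinuousMap from by ext; simp, map_smul,
          smul_apply, inner_smul_right]
        simp }
    (by
      intro f hf
      -- Positivity: with g = √f one has f(U) = g(U)*g(U), so ⟨x, f(U)x⟩ = ‖g(U)x‖².
      let g : C(Circle, ℝ) := ⟨fun z => √(f z), f.continuous.sqrt⟩
      have hfg : circleOfReal f.toContinuousMap = star (circleOfReal g) * circleOfReal g := by
        ext z
        have : √(f z) * √(f z) = f z := Real.mul_self_sqrt (hf z)
        simp only [circleOfReal_apply, ContinuousMap.mul_apply, ContinuousMap.star_apply]
        simp only [g, ContinuousMap.coe_mk, RCLike.star_def, Complex.conj_ofReal]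
        exact_mod_cast this.symm
      change 0 ≤ (inner ℂ x (circleCalculus U (circleOfReal f.toContinuousMap) x)).re
      rw [hfg, map_mul, map_star, mul_apply_eq_comp,
        ContinuousLinearMap.star_eq_adjoint, ContinuousLinearMap.adjoint_inner_right]
      exact inner_self_nonneg (𝕜 := ℂ))

theorem inner_circleCalculus_ofReal_im (U : H ≃ₗᵢ[ℂ] H) (x : H) (f : C(Circle, ℝ)) :
    (inner ℂ x (circleCalculus U (circleOfReal f) x)).im = 0 := by
  have h : star (circleOfReal f) = circleOfReal f := by
    ext z; simp [circleOfReal_apply]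
  have h1 : inner ℂ x (circleCalculus U (circleOfReal f) x) =
      (starRingEnd ℂ) (inner ℂ x (circleCalculus U (circleOfReal f) x)) := by
    rw [inner_conj_symm]
    nth_rewrite 1 [← h]
    rw [map_star, ContinuousLinearMap.star_eq_adjoint, ContinuousLinearMap.adjoint_inner_right]
  exact Complex.conj_eq_iff_im.1 h1.symm

/-- Every vector has a spectral measure. -/
theorem exists_isSpectralMeasure (U : H ≃ₗᵢ[ℂ] H) (x : H) :
    ∃ σ : Measure Circle, IsSpectralMeasure U x σ := by
  refine ⟨RealRMK.rieszMeasure (spectralFunctional U x), inferInstance, fun n => ?_⟩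
  set σ := RealRMK.rieszMeasure (spectralFunctional U x)
  have hreal : ∀ f : C(Circle, ℝ),
      inner ℂ x (circleCalculus U (circleOfReal f) x) = ((∫ z, f z ∂σ : ℝ) : ℂ) := by
    intro f
    have h := RealRMK.integral_rieszMeasure (spectralFunctional U x)
      ⟨f, HasCompactSupport.of_compactSpace _⟩
    apply Complex.ext
    · rw [Complex.ofReal_re]
      exact h.symm
    · rw [inner_circleCalculus_ofReal_im, Complex.ofReal_im]
  let fr : C(Circle, ℝ) := ⟨fun z => (circleMonomial n z).re,
    Complex.continuous_re.comp (circleMonomial n).continuous⟩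
  let fi : C(Circle, ℝ) := ⟨fun z => (circleMonomial n z).im,
    Complex.continuous_im.comp (circleMonomial n).continuous⟩
  -- The Riesz measure only represents real functions, so the monomial is split into real and
  -- imaginary parts.
  have hdec : circleMonomial n = circleOfReal fr + Complex.I • circleOfReal fi := by
    ext z
    simp only [ContinuousMap.add_apply, ContinuousMap.smul_apply, circleOfReal_apply, fr, fi,
      ContinuousMap.coe_mk, smul_eq_mul]
    rw [mul_comm, Complex.re_add_im]
  have hint : Integrable (fun z => circleMonomial n z) σ :=
    (circleMonomial n).continuous.integrable_of_hasCompactSupport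
      (HasCompactSupport.of_compactSpace _)
  rw [← circleCalculus_monomial]
  nth_rewrite 1 [hdec]
  rw [map_add, map_smul, add_apply, smul_apply,
    inner_add_right, inner_smul_right, hreal, hreal]
  change _ = ∫ z, circleMonomial n z ∂σ
  rw [← integral_re_add_im hint, mul_comm]
  rfl

end Calculus
end

noncomputable section

/-! ### Fourier coefficients of measures on the circle -/

section Fourier

/-- The Fourier coefficient `∫ zᵐ dσ(z)`. -/
def circleFourier (σ : Measure Circle) (m : ℤ) : ℂ := ∫ z : Circle, ((z ^ m : Circle) : ℂ) ∂σ

/-- The Cesàro means of the absolute values of the Fourier coefficients of `σ` tend to zero. -/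
def FourierMeansVanish (σ : Measure Circle) : Prop :=
  Tendsto (fun N : ℕ => (N : ℝ)⁻¹ * ∑ m ∈ Finset.range N, ‖circleFourier σ m‖) atTop (𝓝 0)

theorem circleFourier_neg (σ : Measure Circle) (m : ℤ) :
    circleFourier σ (-m) = (starRingEnd ℂ) (circleFourier σ m) := by
  rw [circleFourier, circleFourier, ← integral_conj]
  simp_rw [zpow_neg, Circle.coe_inv_eq_conj]

theorem norm_circleFourier_le (σ : Measure Circle) [IsFiniteMeasure σ] (m : ℤ) :
    ‖circleFourier σ m‖ ≤ σ.real Set.univ := by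
  refine (norm_integral_le_of_norm_le_const (C := 1) (ae_of_all _ fun z => ?_)).trans (by simp)
  rw [Circle.norm_coe]

/-- Away from 1 the geometric sum is bounded by 2/|z - 1| independently of `N`. -/
theorem tendsto_cesaro_pow (z : Circle) :
    Tendsto (fun N : ℕ => (N : ℂ)⁻¹ * ∑ m ∈ Finset.range N, (z : ℂ) ^ m) atTop
      (𝓝 (({1} : Set Circle).indicator (fun _ => 1) z)) := by
  by_cases hz : z = 1
  · refine tendsto_const_nhds.congr' ?_
    filter_upwards [eventually_gt_atTop 0] with N hN
    have : (N : ℂ) ≠ 0 := by exact_mod_cast hN.ne'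
    simp [hz, this]
  · rw [Set.indicator_of_notMem (by simpa using hz)]
    have hz' : (z : ℂ) ≠ 1 := fun h => hz (Circle.ext (by simpa using h))
    have hpos : 0 < ‖(z : ℂ) - 1‖ := norm_pos_iff.2 (sub_ne_zero.2 hz')
    have h0 : Tendsto (fun N : ℕ => (N : ℝ)⁻¹ * (2 / ‖(z : ℂ) - 1‖)) atTop (𝓝 0) := by
      simpa using tendsto_inv_atTop_nhds_zero_nat.mul_const (2 / ‖(z : ℂ) - 1‖)
    refine squeeze_zero_norm (fun N => ?_) h0
    rw [norm_mul, norm_inv, Complex.norm_natCast, geom_sum_eq hz', norm_div]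
    gcongr
    refine (norm_sub_le _ _).trans ?_
    rw [norm_pow, Circle.norm_coe]
    norm_num

/-- **Wiener's lemma**: a measure whose Fourier coefficients tend to zero in mean is atomless. -/
theorem FourierMeansVanish.nullSingletonClass {σ : Measure Circle} [IsFiniteMeasure σ]
    (h : FourierMeansVanish σ) : NullSingletonClass σ := by
  refine ⟨fun w => ?_⟩
  -- The integrand converges boundedly to the indicator of {w}, so these integrals tend to the mass
  -- of `w`. They are also bounded by the means of the |Fourier coefficients|, which vanish.
  have hlim : Tendsto (fun N : ℕ => ∫ z : Circle,
      (N : ℂ)⁻¹ * ∑ m ∈ Finset.range N, ((z * w⁻¹ : Circle) : ℂ) ^ m ∂σ) atTop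
      (𝓝 (∫ z, ({w} : Set Circle).indicator (fun _ => (1 : ℂ)) z ∂σ)) := by
    refine tendsto_integral_of_dominated_convergence (fun _ => 1) ?_ (integrable_const _) ?_ ?_
    · intro N
      have hc : Continuous fun z : Circle =>
          (N : ℂ)⁻¹ * ∑ m ∈ Finset.range N, ((z * w⁻¹ : Circle) : ℂ) ^ m := by
        refine continuous_const.mul (continuous_finsetSum _ fun m _ => Continuous.pow ?_ _)
        exact continuous_subtype_val.comp (continuous_id.mul continuous_const)
      exact hc.aestronglyMeasurable
    · refine fun N => ae_of_all _ fun z => ?_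
      rw [norm_mul, norm_inv, Complex.norm_natCast]
      refine (mul_le_mul_of_nonneg_left (norm_sum_le _ _) (by positivity)).trans ?_
      simp only [norm_pow, Circle.norm_coe, one_pow, Finset.sum_const, Finset.card_range,
        nsmul_eq_mul, mul_one]
      exact inv_mul_le_one
    · refine ae_of_all _ fun z => ?_
      have := tendsto_cesaro_pow (z * w⁻¹)
      have hzw : ({1} : Set Circle).indicator (fun _ => (1 : ℂ)) (z * w⁻¹) =
          ({w} : Set Circle).indicator (fun _ => (1 : ℂ)) z := by
        by_cases h : z = w
        · simp [h]
        · rw [Set.indicator_of_notMem (by simpa [mul_inv_eq_one] using h),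
            Set.indicator_of_notMem (by simpa using h)]
      rwa [hzw] at this
  have hzero : Tendsto (fun N : ℕ => ∫ z : Circle,
      (N : ℂ)⁻¹ * ∑ m ∈ Finset.range N, ((z * w⁻¹ : Circle) : ℂ) ^ m ∂σ) atTop (𝓝 0) := by
    refine squeeze_zero_norm (fun N => ?_) h
    rw [integral_const_mul, norm_mul, norm_inv, Complex.norm_natCast]
    gcongr
    rw [integral_finsetSum]
    · refine (norm_sum_le _ _).trans (Finset.sum_le_sum fun m _ => ?_)
      have : ∀ z : Circle, ((z * w⁻¹ : Circle) : ℂ) ^ m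
          = ((z ^ (m : ℤ) : Circle) : ℂ) * ((w⁻¹ : Circle) : ℂ) ^ m := by
        intro z; simp [mul_pow]
      simp_rw [this]
      rw [integral_mul_const, norm_mul, norm_pow, Circle.norm_coe, one_pow, mul_one]
      rfl
    · intro m _
      have hc : Continuous fun z : Circle => ((z * w⁻¹ : Circle) : ℂ) ^ m :=
        Continuous.pow (continuous_subtype_val.comp (continuous_id.mul continuous_const)) _
      exact hc.integrable_of_hasCompactSupport (HasCompactSupport.of_compactSpace _)
  have heq := tendsto_nhds_unique hlim hzero
  rw [integral_indicator_const _ (measurableSet_singleton w)] at heq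
  have : σ.real {w} = 0 := by simpa using heq
  exact (measureReal_eq_zero_iff).1 this

variable {ι : Type*} [Fintype ι]

/-- The convolution of a finite family of measures on the circle. -/
def familyConvolution (σ : ι → Measure Circle) : Measure Circle :=
  (Measure.pi σ).map fun z => ∏ i, z i

instance (σ : ι → Measure Circle) [∀ i, IsFiniteMeasure (σ i)] :
    IsFiniteMeasure (familyConvolution σ) := by
  unfold familyConvolution; infer_instance

theorem circleFourier_familyConvolution (σ : ι → Measure Circle) [∀ i, IsFiniteMeasure (σ i)]
    (m : ℤ) : circleFourier (familyConvolution σ) m = ∏ i, circleFourier (σ i) m := by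
  have hm : Measurable fun z : ι → Circle => ∏ i, z i :=
    (continuous_finsetProd _ fun i _ => continuous_apply i).measurable
  refine (integral_map hm.aemeasurable
    (circleMonomial m).continuous.aestronglyMeasurable).trans ?_
  refine Eq.trans ?_ (integral_fintype_prod_eq_prod (fun _ z => circleMonomial m z))
  refine integral_congr_ae (ae_of_all _ fun z => ?_)
  simp only [circleMonomial_apply]
  rw [← Finset.prod_zpow]
  exact map_prod Circle.coeHom _ _

theorem FourierMeansVanish.of_norm_le {σ τ : Measure Circle} (h : FourierMeansVanish σ) (C : ℝ)
    (hle : ∀ m, ‖circleFourier τ m‖ ≤ C * ‖circleFourier σ m‖) : FourierMeansVanish τ := by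
  have h' := Tendsto.const_mul C h
  rw [mul_zero] at h'
  refine squeeze_zero (fun N => by positivity) (fun N => ?_) h'
  rw [mul_left_comm]
  refine mul_le_mul_of_nonneg_left ?_ (by positivity)
  rw [Finset.mul_sum]
  exact Finset.sum_le_sum fun m _ => hle m

/-- One factor with vanishing means suffices: the coefficients multiply, and those of the other
factors are bounded by their total masses. -/
theorem FourierMeansVanish.familyConvolution {σ : ι → Measure Circle} [∀ i, IsFiniteMeasure (σ i)]
    (i : ι) (h : FourierMeansVanish (σ i)) : FourierMeansVanish (familyConvolution σ) := by
  classical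
  refine h.of_norm_le (∏ j ∈ Finset.univ.erase i, (σ j).real Set.univ) fun m => ?_
  rw [circleFourier_familyConvolution, norm_prod, ← Finset.prod_erase_mul _ _ (Finset.mem_univ i)]
  gcongr with j _
  exact norm_circleFourier_le _ _

/-- If `n ≥ 1` members of a finite family of measures have Fourier coefficients vanishing in mean,
then the convolution of the family has the Fourier coefficients of a convolution of `n` atomless
measures. -/
theorem exists_circleConvolution_of_embedding {n : ℕ} (hn : 0 < n) (σ : ι → Measure Circle)
    [∀ i, IsFiniteMeasure (σ i)] (e : Fin n ↪ ι) (he : ∀ j, FourierMeansVanish (σ (e j))) :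
    ∃ (ν : Fin n → Measure Circle) (_ : ∀ j, IsFiniteMeasure (ν j))
      (_ : ∀ j, NullSingletonClass (ν j)),
      ∀ m, circleFourier (circleConvolution ν) m = ∏ i, circleFourier (σ i) m := by
  classical
  have : Nonempty (Fin n) := ⟨⟨0, hn⟩⟩
  -- Sort the indices into `n` bins so that `e j` lies in bin `j`; indices outside the range of `e`
  -- go to an arbitrary bin. Each bin then contains a measure with vanishing means, so the
  -- convolution over it is atomless.
  let c : ι → Fin n := Function.invFun e
  have hc : ∀ j, c (e j) = j := Function.leftInverse_invFun e.injective
  let ν : Fin n → Measure Circle := fun j =>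
    familyConvolution fun i : {i // c i = j} => σ i
  have hν : ∀ j, FourierMeansVanish (ν j) := fun j =>
    FourierMeansVanish.familyConvolution (⟨e j, hc j⟩ : {i // c i = j}) (he j)
  refine ⟨ν, fun j => inferInstance, fun j => (hν j).nullSingletonClass, fun m => ?_⟩
  refine (circleFourier_familyConvolution ν m).trans ?_
  simp_rw [ν, circleFourier_familyConvolution]
  exact Fintype.prod_fiberwise c fun i => circleFourier (σ i) m

end Fourier

/-! ### Spectral measures under equivariant isometries, and orthogonality to Hilbert sums -/

section Transfer

variable {H K : Type*} [NormedAddCommGroup H] [InnerProductSpace ℂ H]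
  [NormedAddCommGroup K] [InnerProductSpace ℂ K]

/-- Negative exponents follow by complex conjugation, since `U` is unitary and σ is positive. -/
theorem isSpectralMeasure_of_nat {U : H ≃ₗᵢ[ℂ] H} {x : H} {σ : Measure Circle}
    [IsFiniteMeasure σ] (h : ∀ n : ℕ, inner ℂ x ((U ^ n) x) = circleFourier σ n) :
    IsSpectralMeasure U x σ := by
  refine ⟨inferInstance, fun n => ?_⟩
  change _ = circleFourier σ n
  obtain ⟨m, rfl | rfl⟩ := n.eq_nat_or_neg
  · simpa using h m
  · rw [circleFourier_neg, ← h m, inner_conj_symm, ← (U ^ m).inner_map_map x, zpow_neg,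
      zpow_natCast]
    congr 1
    exact (U ^ m).apply_symm_apply x

theorem IsSpectralMeasure.inner_pow {U : H ≃ₗᵢ[ℂ] H} {x : H} {σ : Measure Circle}
    (h : IsSpectralMeasure U x σ) (n : ℕ) : inner ℂ x ((U ^ n) x) = circleFourier σ n := by
  rw [← zpow_natCast]
  exact h.2 n

/-- Spectral measures are preserved by equivariant isometries. -/
theorem IsSpectralMeasure.map {U : H ≃ₗᵢ[ℂ] H} {V : K ≃ₗᵢ[ℂ] K} {x : H} {σ : Measure Circle}
    (h : IsSpectralMeasure U x σ) (W : H →ₗᵢ[ℂ] K) (hW : ∀ y, W (U y) = V (W y)) :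
    IsSpectralMeasure V (W x) σ := by
  have := h.1
  refine isSpectralMeasure_of_nat fun n => ?_
  have hpow : ∀ n : ℕ, ∀ y, W ((U ^ n) y) = (V ^ n) (W y) := by
    intro n
    induction n with
    | zero => simp
    | succ n ih =>
      intro y
      rw [pow_succ, pow_succ]
      exact (ih (U y)).trans (congrArg _ (hW y))
  rw [← hpow, W.inner_map_map, h.inner_pow]

/-- A vector orthogonal to the images of all the cyclic generators of a Hilbert sum is orthogonal
to the whole image. -/
theorem inner_eq_zero_of_isHilbertSum [CompleteSpace H] {ι : Type*} {U : H ≃ₗᵢ[ℂ] H} {x : ι → H}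
    (hx : IsHilbertSum ℂ (fun i => cyclicSpace U (x i))
      (fun i => (cyclicSpace U (x i)).subtypeₗᵢ))
    (W : H →L[ℂ] K) (b : K) (hb : ∀ i (n : ℤ), inner ℂ b (W ((U ^ n) (x i))) = 0) (y : H) :
    inner ℂ b (W y) = 0 := by
  let L : H →L[ℂ] ℂ := (innerSL ℂ b).comp W
  have hcyc : ∀ i, cyclicSpace U (x i) ≤ LinearMap.ker (L : H →ₗ[ℂ] ℂ) := by
    intro i
    refine Submodule.topologicalClosure_minimal _ ?_ L.isClosed_ker
    rw [Submodule.span_le]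
    rintro - ⟨n, rfl⟩
    exact hb i n
  obtain ⟨w, rfl⟩ : ∃ w, hx.linearIsometryEquiv.symm w = y :=
    ⟨_, hx.linearIsometryEquiv.symm_apply_apply y⟩
  have h1 := (hx.hasSum_linearIsometryEquiv_symm w).mapL L
  have h2 : ∀ i, L ((cyclicSpace U (x i)).subtypeₗᵢ (w i)) = 0 := fun i => hcyc i (w i).2
  simp_rw [h2] at h1
  exact h1.unique hasSum_zero

end Transfer
end

noncomputable section

/-! ### Cesàro mixing and ergodicity -/

section Ergodicity

variable {α : Type*} [MeasurableSpace α]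

/-- The average of the first `N` terms of a sequence of measures. -/
def cesaroMeasure (κ : ℕ → Measure α) (N : ℕ) : Measure α :=
  (N : ENNReal)⁻¹ • ∑ i ∈ Finset.range N, κ i

theorem cesaroMeasure_le {κ : ℕ → Measure α} {m : Measure α} (h : ∀ i, κ i ≤ m) (N : ℕ) :
    cesaroMeasure κ N ≤ m := by
  refine Measure.le_iff'.2 fun s => ?_
  simp only [cesaroMeasure, Measure.smul_apply, Measure.finsetSum_apply, smul_eq_mul]
  calc (N : ENNReal)⁻¹ * ∑ i ∈ Finset.range N, κ i s
      ≤ (N : ENNReal)⁻¹ * ∑ i ∈ Finset.range N, m s := by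
        gcongr with i _
        exact h i
    _ ≤ m s := by
        rw [Finset.sum_const, Finset.card_range, nsmul_eq_mul, ← mul_assoc]
        exact mul_le_of_le_one_left (zero_le) (ENNReal.inv_mul_le_one _)

theorem cesaroMeasure_real (κ : ℕ → Measure α) [∀ i, IsFiniteMeasure (κ i)] (N : ℕ) (s : Set α) :
    (cesaroMeasure κ N).real s = (N : ℝ)⁻¹ * ∑ i ∈ Finset.range N, (κ i).real s := by
  simp only [cesaroMeasure, Measure.real, Measure.smul_apply, Measure.finsetSum_apply, smul_eq_mul,
    ENNReal.toReal_mul, ENNReal.toReal_inv, ENNReal.toReal_natCast]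
  rw [ENNReal.toReal_sum fun i _ => measure_ne_top _ _]

/-- Setwise convergence of dominated measures can be tested on a generating π-system. -/
theorem tendsto_measureReal_of_piSystem {m q : Measure α} [IsFiniteMeasure m] [IsFiniteMeasure q]
    {p : ℕ → Measure α} (hp : ∀ N, p N ≤ m) {C : Set (Set α)}
    (hgen : ‹MeasurableSpace α› = MeasurableSpace.generateFrom C) (hC : IsPiSystem C)
    (huniv : Tendsto (fun N => (p N).real Set.univ) atTop (𝓝 (q.real Set.univ)))
    (hlim : ∀ s ∈ C, Tendsto (fun N => (p N).real s) atTop (𝓝 (q.real s)))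
    (s : Set α) (hs : MeasurableSet s) :
    Tendsto (fun N => (p N).real s) atTop (𝓝 (q.real s)) := by
  have hfin : ∀ N, IsFiniteMeasure (p N) := fun N => isFiniteMeasure_of_le m (hp N)
  induction s, hs using MeasurableSpace.induction_on_inter hgen hC with
  | empty => simp
  | basic t ht => exact hlim t ht
  | compl t ht ih =>
    simp_rw [fun N => measureReal_compl (μ := p N) ht, measureReal_compl (μ := q) ht]
    exact huniv.sub ih
  | iUnion f hd hf ih =>
    have hsum : ∀ (r : Measure α) [IsFiniteMeasure r],
        HasSum (fun j => r.real (f j)) (r.real (⋃ j, f j)) := by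
      intro r _
      have hne : ∑' j, r (f j) ≠ ⊤ := by
        rw [← measure_iUnion hd hf]
        exact measure_ne_top _ _
      rw [Measure.real, measure_iUnion hd hf, ENNReal.tsum_toReal_eq fun j => measure_ne_top _ _]
      exact (ENNReal.summable_toReal hne).hasSum
    simp_rw [fun N => ((hsum (p N)).tsum_eq).symm, ((hsum q).tsum_eq).symm]
    -- Domination by the single finite measure `m` is what allows passing to the limit in countable
    -- unions.
    refine tendsto_tsum_of_dominated_convergence (hsum m).summable ih
      (Eventually.of_forall fun N j => ?_)
    rw [Real.norm_of_nonneg measureReal_nonneg]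
    exact ENNReal.toReal_mono (measure_ne_top _ _) (hp N _)

/-- Cesàro mixing on a generating π-system implies ergodicity. -/
theorem ergodic_of_cesaro_mixing {m : Measure α} [IsProbabilityMeasure m] {R : α → α}
    (hR : MeasurePreserving R m m) {C : Set (Set α)}
    (hgen : ‹MeasurableSpace α› = MeasurableSpace.generateFrom C) (hC : IsPiSystem C)
    (hmix : ∀ s ∈ C, ∀ t ∈ C, Tendsto (fun N : ℕ => (N : ℝ)⁻¹ *
      ∑ i ∈ Finset.range N, m.real (R^[i] ⁻¹' s ∩ t)) atTop (𝓝 (m.real s * m.real t))) :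
    Ergodic R m := by
  have hCm : ∀ s ∈ C, MeasurableSet s := fun s hs => by
    rw [hgen]; exact MeasurableSpace.measurableSet_generateFrom hs
  have hone : ∀ c : ℝ, Tendsto (fun N : ℕ => (N : ℝ)⁻¹ * ∑ i ∈ Finset.range N, c) atTop (𝓝 c) := by
    intro c
    refine tendsto_const_nhds.congr' ?_
    filter_upwards [eventually_gt_atTop 0] with N hN
    have : (N : ℝ) ≠ 0 := by exact_mod_cast hN.ne'
    simp [this]
  have hsmul : ∀ t s : Set α, ((m t) • m).real s = m.real s * m.real t := by
    intro t s
    rw [measureReal_ennreal_smul_apply, mul_comm]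
    rfl
  have hfin : ∀ t : Set α, IsFiniteMeasure ((m t) • m) := fun t =>
    Measure.smul_finite m (measure_ne_top _ _)
  -- Extend mixing from the π-system one set at a time: first in `s` with `t` fixed, then in `t`
  -- with `s` an arbitrary measurable set.
  have hleft : ∀ s, MeasurableSet s → ∀ t ∈ C, Tendsto (fun N : ℕ => (N : ℝ)⁻¹ *
      ∑ i ∈ Finset.range N, m.real (R^[i] ⁻¹' s ∩ t)) atTop (𝓝 (m.real s * m.real t)) := by
    intro s hs t ht
    let κ : ℕ → Measure α := fun i => (m.restrict t).map R^[i]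
    have hκ : ∀ i s, MeasurableSet s → (κ i).real s = m.real (R^[i] ⁻¹' s ∩ t) := by
      intro i s hs
      simp only [κ, Measure.real]
      rw [Measure.map_apply (hR.iterate i).measurable hs,
        Measure.restrict_apply ((hR.iterate i).measurable hs)]
    have hle : ∀ i, κ i ≤ m := fun i =>
      (Measure.map_mono Measure.restrict_le_self (hR.iterate i).measurable).trans
        (hR.iterate i).map_eq.le
    have key := tendsto_measureReal_of_piSystem (q := (m t) • m) (cesaroMeasure_le hle) hgen hC
      ?_ ?_ s hs
    · simpa only [cesaroMeasure_real, hκ _ s hs, hsmul] using key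
    · simp only [cesaroMeasure_real, hκ _ _ MeasurableSet.univ, hsmul]
      simpa using hone (m.real t)
    · intro r hr
      simpa only [cesaroMeasure_real, hκ _ r (hCm r hr), hsmul] using hmix r hr t ht
  have hall : ∀ s, MeasurableSet s → ∀ t, MeasurableSet t → Tendsto (fun N : ℕ => (N : ℝ)⁻¹ *
      ∑ i ∈ Finset.range N, m.real (R^[i] ⁻¹' s ∩ t)) atTop (𝓝 (m.real s * m.real t)) := by
    intro s hs t ht
    let κ : ℕ → Measure α := fun i => m.restrict (R^[i] ⁻¹' s)
    have hκ : ∀ i t, MeasurableSet t → (κ i).real t = m.real (R^[i] ⁻¹' s ∩ t) := by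
      intro i t ht
      simp only [κ, Measure.real]
      rw [Measure.restrict_apply ht, Set.inter_comm]
    have key := tendsto_measureReal_of_piSystem (q := (m s) • m) (p := cesaroMeasure κ)
      (cesaroMeasure_le fun i => Measure.restrict_le_self) hgen hC ?_ ?_ t ht
    · simpa only [cesaroMeasure_real, hκ _ t ht, hsmul, mul_comm (m.real t)] using key
    · simp only [cesaroMeasure_real, hκ _ _ MeasurableSet.univ, hsmul]
      have : ∀ i, m.real (R^[i] ⁻¹' s ∩ Set.univ) = m.real s := fun i => by
        rw [Set.inter_univ, (hR.iterate i).measureReal_preimage hs.nullMeasurableSet]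
      simp_rw [this]
      simpa using hone (m.real s)
    · intro r hr
      simpa only [cesaroMeasure_real, hκ _ r (hCm r hr), hsmul, mul_comm (m.real r)]
        using hleft s hs r hr
  refine ⟨hR, ⟨fun s hs hinv => ?_⟩⟩
  have hpre : ∀ i, R^[i] ⁻¹' s = s := by
    intro i
    induction i with
    | zero => rfl
    | succ i ih => rw [Function.iterate_succ, Set.preimage_comp, ih, hinv]
  -- For an invariant set, mixing with itself reads m(s) = m(s)².
  have h1 := hall s hs s hs
  simp_rw [hpre, Set.inter_self] at h1
  have h2 := tendsto_nhds_unique h1 (hone _)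
  have h3 : m.real s = 0 ∨ m.real s = 1 := by
    rcases eq_or_ne (m.real s) 0 with h | h
    · exact Or.inl h
    · exact Or.inr (mul_right_cancel₀ h (by rw [h2, one_mul]))
  rw [eventuallyConst_set']
  rcases h3 with h | h
  · exact Or.inl (ae_eq_empty.2 ((measureReal_eq_zero_iff).1 h))
  · refine Or.inr ?_
    rw [ae_eq_univ, prob_compl_eq_zero_iff hs]
    rw [Measure.real, ENNReal.toReal_eq_one_iff] at h
    exact h

/-- Ergodic transformations are Cesàro mixing. -/
theorem Ergodic.cesaro_mixing {m : Measure α} [IsProbabilityMeasure m] {R : α → α}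
    (hR : Ergodic R m) {s t : Set α} (hs : MeasurableSet s) (ht : MeasurableSet t) :
    Tendsto (fun N : ℕ => (N : ℝ)⁻¹ *
      ∑ i ∈ Finset.range N, m.real (R^[i] ⁻¹' s ∩ t)) atTop (𝓝 (m.real s * m.real t)) := by
  let W : Lp ℝ 2 m →L[ℝ] Lp ℝ 2 m :=
    (Lp.compMeasurePreservingₗᵢ ℝ R hR.toMeasurePreserving).toContinuousLinearMap
  have hW : ‖W‖ ≤ 1 := LinearIsometry.norm_toContinuousLinearMap_le _
  let f : Lp ℝ 2 m := indicatorConstLp 2 hs (measure_ne_top _ _) 1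
  -- Von Neumann's mean ergodic theorem; ergodicity makes the limit `P` a constant `c`.
  have hlim := W.tendsto_birkhoffAverage_orthogonalProjection hW f
  set P : Lp ℝ 2 m :=
    ((W.eqLocus (1 : Lp ℝ 2 m →L[ℝ] Lp ℝ 2 m)).orthogonalProjectionOnto f).1
  have hP : W P = P :=
    ((W.eqLocus (1 : Lp ℝ 2 m →L[ℝ] Lp ℝ 2 m)).orthogonalProjectionOnto f).2
  obtain ⟨c, hc⟩ := hR.eq_const_of_compMeasurePreserving_eq (g := (P : α →ₘ[m] ℝ))
    (congrArg Subtype.val hP)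
  have hc' : (P : α → ℝ) =ᵐ[m] fun _ => c := by
    rw [hc]; exact AEEqFun.coeFn_const α c
  have hiter : ∀ i, W^[i] f =
      indicatorConstLp 2 ((hR.toMeasurePreserving.iterate i).measurable hs)
        (measure_ne_top _ _) 1 := by
    intro i
    induction i with
    | zero => rfl
    | succ i ih =>
      rw [Function.iterate_succ_apply', ih]
      rfl
  have hinner : ∀ r, (hr : MeasurableSet r) → Tendsto (fun N : ℕ => (N : ℝ)⁻¹ *
      ∑ i ∈ Finset.range N, m.real (R^[i] ⁻¹' s ∩ r)) atTop (𝓝 (c * m.real r)) := by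
    intro r hr
    let g : Lp ℝ 2 m := indicatorConstLp 2 hr (measure_ne_top _ _) 1
    have h1 : Tendsto (fun N => inner ℝ g (birkhoffAverage ℝ W _root_.id N f)) atTop
        (𝓝 (inner ℝ g P)) := tendsto_const_nhds.inner hlim
    have h2 : inner ℝ g P = c * m.real r := by
      rw [L2.inner_indicatorConstLp_one hr (measure_ne_top _ _) P,
        setIntegral_congr_ae hr (hc'.mono fun x hx _ => hx)]
      simp [mul_comm]
    rw [h2] at h1
    refine h1.congr fun N => ?_
    rw [birkhoffAverage, birkhoffSum, inner_smul_right, inner_sum]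
    congr 1
    refine Finset.sum_congr rfl fun i _ => ?_
    rw [id, hiter, L2.real_inner_indicatorConstLp_one_indicatorConstLp_one, Set.inter_comm]
  -- The constant is found by testing against the whole space.
  have hcs : c = m.real s := by
    have h1 := hinner Set.univ MeasurableSet.univ
    have h2 : ∀ i, m.real (R^[i] ⁻¹' s ∩ Set.univ) = m.real s := fun i => by
      rw [Set.inter_univ, (hR.toMeasurePreserving.iterate i).measureReal_preimage
        hs.nullMeasurableSet]
    simp_rw [h2] at h1
    have h3 : Tendsto (fun N : ℕ => (N : ℝ)⁻¹ * ∑ i ∈ Finset.range N, m.real s) atTop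
        (𝓝 (m.real s)) := by
      refine tendsto_const_nhds.congr' ?_
      filter_upwards [eventually_gt_atTop 0] with N hN
      have : (N : ℝ) ≠ 0 := by exact_mod_cast hN.ne'
      simp [this]
    simpa using tendsto_nhds_unique h1 h3
  rw [← hcs]
  exact hinner t ht

/-- Telescoping: the factors are exchanged one at a time, all others being at most 1 in absolute
value. -/
theorem abs_prod_sub_prod_le_sum {ι : Type*} (s : Finset ι) (a b : ι → ℝ)
    (ha : ∀ i, |a i| ≤ 1) (hb : ∀ i, |b i| ≤ 1) :
    |∏ i ∈ s, a i - ∏ i ∈ s, b i| ≤ ∑ i ∈ s, |a i - b i| := by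
  classical
  induction s using Finset.induction_on with
  | empty => simp
  | insert i s hi ih =>
    rw [Finset.prod_insert hi, Finset.prod_insert hi, Finset.sum_insert hi]
    have hp : |∏ j ∈ s, a j| ≤ 1 := by
      rw [Finset.abs_prod]
      exact Finset.prod_le_one (fun _ _ => abs_nonneg _) fun j _ => ha j
    calc |a i * ∏ j ∈ s, a j - b i * ∏ j ∈ s, b j|
        = |(a i - b i) * ∏ j ∈ s, a j + b i * (∏ j ∈ s, a j - ∏ j ∈ s, b j)| := by ring_nf
      _ ≤ |a i - b i| * |∏ j ∈ s, a j| + |b i| * |∏ j ∈ s, a j - ∏ j ∈ s, b j| := by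
        rw [← abs_mul, ← abs_mul]; exact abs_add_le _ _
      _ ≤ |a i - b i| * 1 + 1 * ∑ j ∈ s, |a j - b j| := by
        gcongr
        exact hb i
      _ = _ := by ring

/-- The factors `b j` converge in the strong Cesàro sense, so replacing them by their limits costs
nothing on average; `a` then needs only ordinary Cesàro convergence. This is where weak mixing,
rather than ergodicity, of the Sᵢ enters. -/
theorem tendsto_cesaro_mul_prod {ι : Type*} [Fintype ι] {a : ℕ → ℝ} {a₀ : ℝ} {b : ι → ℕ → ℝ}
    {b₀ : ι → ℝ} (ha : ∀ i, |a i| ≤ 1) (hb : ∀ j i, |b j i| ≤ 1) (hb₀ : ∀ j, |b₀ j| ≤ 1)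
    (halim : Tendsto (fun N : ℕ => (N : ℝ)⁻¹ * ∑ i ∈ Finset.range N, a i) atTop (𝓝 a₀))
    (hblim : ∀ j, Tendsto (fun N : ℕ => (N : ℝ)⁻¹ * ∑ i ∈ Finset.range N, |b j i - b₀ j|)
      atTop (𝓝 0)) :
    Tendsto (fun N : ℕ => (N : ℝ)⁻¹ * ∑ i ∈ Finset.range N, a i * ∏ j, b j i) atTop
      (𝓝 (a₀ * ∏ j, b₀ j)) := by
  have h1 : Tendsto (fun N : ℕ => (N : ℝ)⁻¹ * ∑ i ∈ Finset.range N,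
      a i * (∏ j, b j i - ∏ j, b₀ j)) atTop (𝓝 0) := by
    have h2 := tendsto_finsetSum (Finset.univ : Finset ι) fun j _ => hblim j
    rw [Finset.sum_const_zero] at h2
    refine squeeze_zero_norm (fun N => ?_) h2
    rw [← Finset.mul_sum, Finset.sum_comm, norm_mul, norm_inv, Real.norm_natCast]
    refine mul_le_mul_of_nonneg_left ?_ (by positivity)
    refine (norm_sum_le _ _).trans (Finset.sum_le_sum fun i _ => ?_)
    rw [norm_mul, Real.norm_eq_abs, Real.norm_eq_abs]
    calc |a i| * |∏ j, b j i - ∏ j, b₀ j| ≤ 1 * |∏ j, b j i - ∏ j, b₀ j| := by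
          gcongr; exact ha i
      _ ≤ _ := by
          rw [one_mul]
          exact abs_prod_sub_prod_le_sum _ _ _ (fun j => hb j i) hb₀
  have h3 := h1.add (halim.mul_const (∏ j, b₀ j))
  rw [zero_add] at h3
  refine h3.congr fun N => ?_
  rw [mul_assoc, ← mul_add, Finset.sum_mul, ← Finset.sum_add_distrib]
  congr 1
  exact Finset.sum_congr rfl fun i _ => by ring

/-- The boxes `B × ∏ᵢ Aᵢ` with measurable sides. -/
def measurableBoxes (α : Type*) [MeasurableSpace α] {ι : Type*} (Y : ι → Type*)
    [∀ i, MeasurableSpace (Y i)] : Set (Set (α × ∀ i, Y i)) :=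
  Set.image2 (· ×ˢ ·) {s | MeasurableSet s}
    (Set.pi Set.univ '' Set.pi Set.univ fun i => {s : Set (Y i) | MeasurableSet s})

theorem generateFrom_measurableBoxes {ι : Type*} [Finite ι] (Y : ι → Type*)
    [∀ i, MeasurableSpace (Y i)] :
    MeasurableSpace.generateFrom (measurableBoxes α Y) = Prod.instMeasurableSpace :=
  generateFrom_eq_prod MeasurableSpace.generateFrom_measurableSet generateFrom_pi
    isCountablySpanning_measurableSet
    ⟨fun _ => Set.univ, fun _ => ⟨fun _ => Set.univ, by simp, by simp⟩, Set.iUnion_const _⟩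

theorem isPiSystem_measurableBoxes {ι : Type*} (Y : ι → Type*) [∀ i, MeasurableSpace (Y i)] :
    IsPiSystem (measurableBoxes α Y) :=
  MeasurableSpace.isPiSystem_measurableSet.prod isPiSystem_pi

theorem univ_mem_measurableBoxes {ι : Type*} (Y : ι → Type*) [∀ i, MeasurableSpace (Y i)] :
    Set.univ ∈ measurableBoxes α Y :=
  ⟨Set.univ, MeasurableSet.univ, Set.univ, ⟨fun _ => Set.univ, by simp, by simp⟩, by simp⟩

/-- The product of an ergodic system with finitely many weakly mixing ones is ergodic. -/
theorem ergodic_prod_pi {ι : Type*} [Fintype ι] {Y : ι → Type*} [∀ i, MeasurableSpace (Y i)]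
    {m : Measure α} [IsProbabilityMeasure m] {R : α → α} (hR : Ergodic R m)
    {ν : ∀ i, Measure (Y i)} [∀ i, IsProbabilityMeasure (ν i)] {S : ∀ i, Y i ≃ᵐ Y i}
    (hS : ∀ i, IsWeaklyMixing (ν i) (S i)) :
    Ergodic (Prod.map R fun (y : ∀ i, Y i) i => S i (y i)) (m.prod (Measure.pi ν)) := by
  have hpi : MeasurePreserving (fun (y : ∀ i, Y i) i => S i (y i)) (Measure.pi ν)
      (Measure.pi ν) := measurePreserving_pi _ _ fun i => (hS i).1
  -- On boxes the correlations factor: the base contributes an ordinary Cesàro limit, each weakly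
  -- mixing factor a strong one.
  refine ergodic_of_cesaro_mixing (hR.toMeasurePreserving.prod hpi)
    (generateFrom_measurableBoxes Y).symm (isPiSystem_measurableBoxes Y) ?_
  rintro _ ⟨A, hA, _, ⟨D, hD, rfl⟩, rfl⟩ _ ⟨B, hB, _, ⟨E, hE, rfl⟩, rfl⟩
  have hA : MeasurableSet A := hA
  have hB : MeasurableSet B := hB
  have hD : ∀ i, MeasurableSet (D i) := fun i => hD i trivial
  have hE : ∀ i, MeasurableSet (E i) := fun i => hE i trivial
  have hiter : ∀ i, (Prod.map R fun (y : ∀ i, Y i) i => S i (y i))^[i] =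
      Prod.map R^[i] fun (y : ∀ i, Y i) j => (S j)^[i] (y j) := by
    intro i
    induction i with
    | zero => rfl
    | succ i ih => rw [Function.iterate_succ, ih]; rfl
  have hset : ∀ i, (Prod.map R fun (y : ∀ i, Y i) i => S i (y i))^[i] ⁻¹'
      (A ×ˢ Set.univ.pi D) ∩ B ×ˢ Set.univ.pi E =
      (R^[i] ⁻¹' A ∩ B) ×ˢ Set.univ.pi fun j => (S j)^[i] ⁻¹' (D j) ∩ E j := by
    intro i
    rw [hiter]
    ext ⟨x, y⟩
    simp only [Set.mem_inter_iff, Set.mem_preimage, Prod.map_apply, Set.mem_prod, Set.mem_pi,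
      Set.mem_univ, true_imp_iff, forall_and]
    tauto
  have hreal : ∀ (A : Set α) (D : ∀ i, Set (Y i)), (m.prod (Measure.pi ν)).real
      (A ×ˢ Set.univ.pi D) = m.real A * ∏ j, (ν j).real (D j) := by
    intro A D
    simp only [Measure.real]
    rw [Measure.prod_prod, Measure.pi_pi, ENNReal.toReal_mul, ENNReal.toReal_prod]
  simp_rw [hset, hreal]
  have hle : ∀ {β : Type _} [MeasurableSpace β] (τ : Measure β) [IsProbabilityMeasure τ]
      (s : Set β), |τ.real s| ≤ 1 := by
    intro β _ τ _ s
    rw [abs_of_nonneg measureReal_nonneg]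
    exact measureReal_le_one
  have key := tendsto_cesaro_mul_prod (a := fun i => m.real (R^[i] ⁻¹' A ∩ B))
    (b := fun j i => (ν j).real ((S j)^[i] ⁻¹' (D j) ∩ E j))
    (b₀ := fun j => (ν j).real (D j) * (ν j).real (E j))
    (fun i => by rw [abs_of_nonneg measureReal_nonneg]; exact measureReal_le_one)
    (fun j i => hle _ _)
    (fun j => by
      rw [abs_mul]
      exact mul_le_one₀ (hle _ _) (abs_nonneg _) (hle _ _))
    (hR.cesaro_mixing hA hB) (fun j => (hS j).2 _ _ (hD j) (hE j))
  rw [Finset.prod_mul_distrib] at key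
  convert key using 2
  ring

/-- Two ergodic probability measures are equal or mutually singular. -/
theorem Ergodic.eq_or_mutuallySingular {m₁ m₂ : Measure α} [IsProbabilityMeasure m₁]
    [IsProbabilityMeasure m₂] {R : α → α} (h₁ : Ergodic R m₁) (h₂ : Ergodic R m₂) :
    m₁ = m₂ ∨ m₁.MutuallySingular m₂ := by
  -- The absolutely continuous part of `m₁` with respect to `m₂` is again invariant, hence a
  -- multiple `c` of the ergodic `m₂`. If c = 0 the measures are singular; otherwise `m₂ ≪ m₁`, and
  -- ergodicity of `m₁` forces equality.
  obtain ⟨c, hc⟩ := h₂.eq_smul_of_absolutelyContinuous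
    (h₁.toMeasurePreserving.withDensity_rnDeriv h₂.toMeasurePreserving)
    (withDensity_absolutelyContinuous _ _)
  have hdec := Measure.rnDeriv_add_singularPart m₁ m₂
  rcases eq_or_ne c 0 with rfl | hc0
  · right
    rw [zero_smul] at hc
    rw [hc, zero_add] at hdec
    rw [← hdec]
    exact Measure.mutuallySingular_singularPart _ _
  · left
    have hac : m₂ ≪ m₁ := by
      refine Measure.AbsolutelyContinuous.trans (Measure.absolutelyContinuous_smul hc0) ?_
      rw [← hc]
      exact Measure.absolutelyContinuous_of_le (Measure.withDensity_rnDeriv_le _ _)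
    exact (h₁.eq_of_absolutelyContinuous h₂.toMeasurePreserving hac).symm

end Ergodicity
end

noncomputable section

/-! ### Correlations of products of centered indicators -/

section Koopman

variable {α : Type*} [MeasurableSpace α]

theorem koopman_pow_toLp {m : Measure α} {R : α ≃ᵐ α} (hR : MeasurePreserving R m m) {f : α → ℂ}
    (hf : MemLp f 2 m) (n : ℕ) :
    (koopman m R hR ^ n) (hf.toLp f) =
      (hf.comp_measurePreserving (hR.iterate n)).toLp (f ∘ R^[n]) := by
  induction n with
  | zero => rfl
  | succ n ih =>
    rw [pow_succ']
    change koopman m R hR ((koopman m R hR ^ n) (hf.toLp f)) = _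
    rw [ih]
    rfl

theorem inner_koopman_pow_toLp {m : Measure α} {R : α ≃ᵐ α} (hR : MeasurePreserving R m m)
    {f : α → ℂ} (hf : MemLp f 2 m) (n : ℕ) :
    inner ℂ (hf.toLp f) ((koopman m R hR ^ n) (hf.toLp f)) =
      ∫ x, (starRingEnd ℂ) (f x) * f (R^[n] x) ∂m := by
  rw [koopman_pow_toLp, L2.inner_def]
  refine integral_congr_ae ?_
  filter_upwards [hf.coeFn_toLp, (hf.comp_measurePreserving (hR.iterate n)).coeFn_toLp]
    with x hx hx'
  rw [hx, hx', RCLike.inner_apply, mul_comm]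
  rfl

theorem IsSpectralMeasure.zpow_apply {H : Type*} [NormedAddCommGroup H] [InnerProductSpace ℂ H]
    {U : H ≃ₗᵢ[ℂ] H} {x : H} {σ : Measure Circle} (h : IsSpectralMeasure U x σ) (n : ℤ) :
    IsSpectralMeasure U ((U ^ n) x) σ :=
  h.map (U ^ n).toLinearIsometry fun y => by
    change (U ^ n * U) y = (U * U ^ n) y
    rw [(Commute.zpow_self U n).eq]

/-- The centered indicator function `1_A - m(A)`. -/
def centeredIndicator (m : Measure α) (A : Set α) (x : α) : ℝ :=
  A.indicator (fun _ => 1) x - m.real A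

theorem measurable_centeredIndicator {m : Measure α} {A : Set α} (hA : MeasurableSet A) :
    Measurable (centeredIndicator m A) :=
  (measurable_const.indicator hA).sub measurable_const

theorem abs_centeredIndicator_le (m : Measure α) [IsProbabilityMeasure m] (A : Set α) (x : α) :
    |centeredIndicator m A x| ≤ 1 := by
  have h0 : 0 ≤ m.real A := measureReal_nonneg
  have h1 : m.real A ≤ 1 := measureReal_le_one
  unfold centeredIndicator
  by_cases hx : x ∈ A
  · rw [Set.indicator_of_mem hx, abs_le]; constructor <;> linarith
  · rw [Set.indicator_of_notMem hx, abs_le]; constructor <;> linarith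

/-- Identifies the autocorrelations of a centered indicator with the differences occurring in the
definition of weak mixing. -/
theorem integral_centeredIndicator_mul {m : Measure α} [IsProbabilityMeasure m] {A : Set α}
    (hA : MeasurableSet A) {R : α → α} (hR : MeasurePreserving R m m) :
    ∫ x, centeredIndicator m A x * centeredIndicator m A (R x) ∂m =
      m.real (R ⁻¹' A ∩ A) - m.real A * m.real A := by
  have hRA : MeasurableSet (R ⁻¹' A) := hR.measurable hA
  have heq : ∀ x, centeredIndicator m A x * centeredIndicator m A (R x) =
      (R ⁻¹' A ∩ A).indicator (fun _ => (1 : ℝ)) x - m.real A * A.indicator (fun _ => (1 : ℝ)) x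
        - (m.real A * (R ⁻¹' A).indicator (fun _ => (1 : ℝ)) x - m.real A * m.real A) := by
    intro x
    have h1 : A.indicator (fun _ => (1 : ℝ)) (R x) = (R ⁻¹' A).indicator (fun _ => (1 : ℝ)) x := rfl
    have h2 : (R ⁻¹' A ∩ A).indicator (fun _ => (1 : ℝ)) x =
        (R ⁻¹' A).indicator (fun _ => (1 : ℝ)) x * A.indicator (fun _ => (1 : ℝ)) x := by
      rw [← Set.inter_indicator_mul]
      simp
    simp only [centeredIndicator]
    rw [h1, h2]
    ring
  have hint : ∀ s, MeasurableSet s → Integrable (s.indicator fun _ => (1 : ℝ)) m := fun s hs =>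
    (integrable_const _).indicator hs
  simp_rw [heq]
  rw [integral_sub, integral_sub, integral_sub, integral_const_mul, integral_const_mul,
    integral_indicator_const _ (hRA.inter hA), integral_indicator_const _ hA,
    integral_indicator_const _ hRA, hR.measureReal_preimage hA.nullMeasurableSet]
  · simp
  · exact (hint _ hRA).const_mul _
  · exact integrable_const _
  · exact hint _ (hRA.inter hA)
  · exact (hint _ hA).const_mul _
  · exact (hint _ (hRA.inter hA)).sub ((hint _ hA).const_mul _)
  · exact ((hint _ hRA).const_mul _).sub (integrable_const _)

/-- The autocorrelations of a bounded real function are Fourier coefficients of a measure. -/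
theorem exists_circleFourier_eq_correlation {m : Measure α} [IsProbabilityMeasure m] {R : α ≃ᵐ α}
    (hR : MeasurePreserving R m m) {f : α → ℝ} (hf : Measurable f) (hb : ∀ x, |f x| ≤ 1) :
    ∃ σ : Measure Circle, IsFiniteMeasure σ ∧
      ∀ n : ℕ, circleFourier σ n = ((∫ x, f x * f (R^[n] x) ∂m : ℝ) : ℂ) := by
  have hL : MemLp (fun x => (f x : ℂ)) 2 m :=
    MemLp.of_bound (Complex.measurable_ofReal.comp hf).aestronglyMeasurable 1
      (ae_of_all _ fun x => by simpa using hb x)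
  obtain ⟨σ, hσ⟩ := exists_isSpectralMeasure (koopman m R hR) (hL.toLp _)
  refine ⟨σ, hσ.1, fun n => ?_⟩
  rw [← hσ.inner_pow, inner_koopman_pow_toLp, ← integral_complex_ofReal]
  simp

end Koopman

/-! ### Orthogonality of L²(X) to products of many centered indicators -/

section Vanishing

variable {X : Type*} [MeasurableSpace X] {ι : Type*} [Fintype ι]
  {Y : ι → Type*} [∀ i, MeasurableSpace (Y i)]

/-- If `T` has the property `CS(n)`, a joining of `T` with a product of weakly mixing automorphisms
gives correlation zero to a set in the first factor and a product of at least `n` centered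
indicators. -/
theorem HasCS.integral_indicator_mul_prod_eq_zero {μ : Measure X}
    {T : X ≃ᵐ X} {hT : MeasurePreserving T μ μ} {n : ℕ} (hn : 0 < n) (hCS : HasCS n μ T hT)
    {ν : ∀ i, Measure (Y i)} [∀ i, IsProbabilityMeasure (ν i)] {S : ∀ i, Y i ≃ᵐ Y i}
    (hS : ∀ i, IsWeaklyMixing (ν i) (S i)) {lam : Measure (X × ∀ i, Y i)}
    [IsProbabilityMeasure lam]
    (hfst : MeasurePreserving Prod.fst lam μ) (hsnd : MeasurePreserving Prod.snd lam (Measure.pi ν))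
    (hlam : MeasurePreserving (T.prodCongr (MeasurableEquiv.piCongrRight S)) lam lam)
    {B : Set X} (hB : MeasurableSet B) {A : ∀ i, Set (Y i)} (hA : ∀ i, MeasurableSet (A i))
    {I : Finset ι} (hI : n ≤ I.card) :
    ∫ p, B.indicator (fun _ => (1 : ℝ)) p.1 *
      ∏ i ∈ I, centeredIndicator (ν i) (A i) (p.2 i) ∂lam = 0 := by
  classical
  have : IsProbabilityMeasure μ := 
    hfst.map_eq ▸ Measure.isProbabilityMeasure_map hfst.measurable.aemeasurable
  let R := T.prodCongr (MeasurableEquiv.piCongrRight S)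
  -- Padding by the constant 1 outside `I` turns the product over `I` into one over all coordinates,
  -- to which the product structure of ν applies.
  let h : ∀ i, Y i → ℝ := fun i => if i ∈ I then centeredIndicator (ν i) (A i) else fun _ => 1
  have hh : ∀ i, Measurable (h i) := by
    intro i
    by_cases hi : i ∈ I
    · simp only [h, hi, if_true]; exact measurable_centeredIndicator (hA i)
    · simp only [h, hi, if_false]; exact measurable_const
  have hb : ∀ i y, |h i y| ≤ 1 := by
    intro i y
    by_cases hi : i ∈ I
    · simp only [h, hi, if_true]; exact abs_centeredIndicator_le _ _ _
    · simp [h, hi]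
  choose σ hσfin hσ using fun i =>
    exists_circleFourier_eq_correlation (hS i).1 (hh i) (hb i)
  have hvan : ∀ i ∈ I, FourierMeansVanish (σ i) := by
    intro i hi
    refine ((hS i).2 (A i) (A i) (hA i) (hA i)).congr fun N => ?_
    congr 1
    refine Finset.sum_congr rfl fun m _ => ?_
    rw [hσ, Complex.norm_real, Real.norm_eq_abs]
    simp only [h, hi, if_true]
    rw [integral_centeredIndicator_mul (hA i) ((hS i).1.iterate m)]
  -- Any `n` of the indices in `I` seed the bins; the remaining factors are absorbed into the
  -- resulting `n` atomless measures.
  obtain ⟨J, hJI, hJ⟩ := Finset.exists_subset_card_eq hI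
  let e : Fin n ↪ ι := (J.equivFinOfCardEq hJ).symm.toEmbedding.trans (Function.Embedding.subtype _)
  obtain ⟨τ', hτfin, hτat, hτ'⟩ := exists_circleConvolution_of_embedding hn σ e
    fun j => hvan _ (hJI ((J.equivFinOfCardEq hJ).symm j).2)
  let G : X × (∀ i, Y i) → ℂ := fun p => ((∏ i, h i (p.2 i) : ℝ) : ℂ)
  have hGm : Measurable G := Complex.measurable_ofReal.comp
    (Finset.measurable_prod _ fun i _ =>
      (hh i).comp ((measurable_pi_apply i).comp measurable_snd))
  have hG : MemLp G 2 lam := by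
    refine MemLp.of_bound hGm.aestronglyMeasurable 1 (ae_of_all _ fun p => ?_)
    simp only [G, Complex.norm_real, Real.norm_eq_abs, Finset.abs_prod]
    exact Finset.prod_le_one (fun _ _ => abs_nonneg _) fun i _ => hb i _
  have hiter : ∀ (m : ℕ) (p : X × ∀ i, Y i) (i : ι), (R^[m] p).2 i = (S i)^[m] (p.2 i) := by
    intro m
    induction m with
    | zero => intro p i; rfl
    | succ m ih =>
      intro p i
      rw [Function.iterate_succ_apply, Function.iterate_succ_apply, ih]
      rfl
  have : IsFiniteMeasure (circleConvolution τ') := by unfold circleConvolution; infer_instance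
  -- `G` depends only on the Y-coordinates, whose law under `lam` is the product of the ν i, so its
  -- autocorrelations factor.
  have hGspec : IsSpectralMeasure (koopman lam R hlam) (hG.toLp G) (circleConvolution τ') := by
    refine isSpectralMeasure_of_nat fun m => ?_
    rw [inner_koopman_pow_toLp, hτ']
    simp only [hσ]
    have h1 : ∀ p : X × ∀ i, Y i, (starRingEnd ℂ) (G p) * G (R^[m] p) =
        (((fun y : ∀ i, Y i => ∏ i, (h i (y i) * h i ((S i)^[m] (y i)))) p.2 : ℝ) : ℂ) := by
      intro p
      simp only [G, hiter, Complex.conj_ofReal]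
      rw [← Complex.ofReal_mul, Finset.prod_mul_distrib]
    simp_rw [h1]
    rw [integral_complex_ofReal, ← Complex.ofReal_prod,
      ← integral_fintype_prod_eq_prod (fun i y => h i y * h i ((S i)^[m] y)), ← hsnd.map_eq,
      integral_map hsnd.measurable.aemeasurable]
    refine Measurable.aestronglyMeasurable (Finset.measurable_prod _ fun i _ => ?_)
    exact ((hh i).comp (measurable_pi_apply i)).mul
      (((hh i).comp ((hS i).1.iterate m).measurable).comp (measurable_pi_apply i))
  obtain ⟨ρ, ⟨-, x, τ, hsum, hx, hτ, -, hτρ⟩, hρ⟩ := hCS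
  have hac : ∀ i, τ i ≪ ρ := by
    intro i
    induction i with
    | zero => exact hτρ
    | succ i ih => exact (hτ i).trans ih
  let W : Lp ℂ 2 μ →ₗᵢ[ℂ] Lp ℂ 2 lam := Lp.compMeasurePreservingₗᵢ ℂ Prod.fst hfst
  have hW : ∀ f, W (koopman μ T hT f) = koopman lam R hlam (W f) := by
    intro f
    change Lp.compMeasurePreserving Prod.fst hfst (Lp.compMeasurePreserving T hT f) =
      Lp.compMeasurePreserving R hlam (Lp.compMeasurePreserving Prod.fst hfst f)
    rw [← Lp.compMeasurePreserving_comp_apply, ← Lp.compMeasurePreserving_comp_apply]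
    rfl
  have hBL : MemLp (B.indicator fun _ => (1 : ℂ)) 2 μ :=
    memLp_indicator_const _ hB _ (Or.inr (measure_ne_top _ _))
  -- Translates of the cyclic generators keep their spectral measures in L²(lam). All of these are
  -- dominated by ρ, hence singular to that of `G`.
  have hzero := inner_eq_zero_of_isHilbertSum hsum W.toContinuousLinearMap (hG.toLp G)
    (fun i m => hGspec.inner_eq_zero (((hx i).zpow_apply m).map W hW)
      ((hρ τ').symm.mono_ac Measure.AbsolutelyContinuous.rfl (hac i))) (hBL.toLp _)
  have hWB : W (hBL.toLp _) = (hBL.comp_measurePreserving hfst).toLp _ := rfl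
  change inner ℂ (hG.toLp G) (W (hBL.toLp _)) = 0 at hzero
  rw [hWB, L2.inner_def] at hzero
  have hprod : ∀ p : X × ∀ i, Y i, ∏ i, h i (p.2 i) =
      ∏ i ∈ I, centeredIndicator (ν i) (A i) (p.2 i) := by
    intro p
    rw [← Finset.prod_subset (Finset.subset_univ I) fun i _ hi => by simp [h, hi]]
    exact Finset.prod_congr rfl fun i hi => by simp [h, hi]
  have hfinal : ((∫ p, B.indicator (fun _ => (1 : ℝ)) p.1 *
      ∏ i ∈ I, centeredIndicator (ν i) (A i) (p.2 i) ∂lam : ℝ) : ℂ) = 0 := by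
    rw [← hzero, ← integral_complex_ofReal]
    refine integral_congr_ae ?_
    filter_upwards [hG.coeFn_toLp, (hBL.comp_measurePreserving hfst).coeFn_toLp] with p hp hp'
    rw [hp, hp', RCLike.inner_apply, ← hprod]
    simp only [G, Complex.conj_ofReal, Complex.ofReal_mul, Function.comp_apply]
    congr 1
    by_cases hpB : p.1 ∈ B <;> simp [hpB]
  exact_mod_cast hfinal

end Vanishing
end

noncomputable section

/-! ### Replacing coordinates of a joining by independent ones -/

section Decoupling

variable {X : Type*} [MeasurableSpace X] {ι : Type*} [Fintype ι] [DecidableEq ι]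
  {Y : ι → Type*} [∀ i, MeasurableSpace (Y i)]

/-- The map which keeps the coordinates in `J` of the first point of `∏ᵢ Yᵢ` and takes the
remaining ones from the second. -/
def mixCoordinates (J : Finset ι) (q : (X × ∀ i, Y i) × ∀ i, Y i) : X × ∀ i, Y i :=
  (q.1.1, fun i => if i ∈ J then q.1.2 i else q.2 i)

theorem measurable_mixCoordinates (J : Finset ι) :
    Measurable (mixCoordinates (X := X) (Y := Y) J) := by
  refine (measurable_fst.comp measurable_fst).prodMk (measurable_pi_lambda _ fun i => ?_)
  by_cases hi : i ∈ J
  · simp only [hi, if_true]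
    exact (measurable_pi_apply i).comp (measurable_snd.comp measurable_fst)
  · simp only [hi, if_false]
    exact (measurable_pi_apply i).comp measurable_snd

/-- The measure obtained from `lam` by replacing the coordinates outside `J` by independent ones
with distributions `ν i`. -/
def decouple (lam : Measure (X × ∀ i, Y i)) (ν : ∀ i, Measure (Y i)) (J : Finset ι) :
    Measure (X × ∀ i, Y i) :=
  (lam.prod (Measure.pi ν)).map (mixCoordinates J)

variable {lam : Measure (X × ∀ i, Y i)} [IsProbabilityMeasure lam]
  {ν : ∀ i, Measure (Y i)} [∀ i, IsProbabilityMeasure (ν i)]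

instance (J : Finset ι) : IsProbabilityMeasure (decouple lam ν J) :=
  Measure.isProbabilityMeasure_map (measurable_mixCoordinates J).aemeasurable

theorem decouple_box (J : Finset ι) {B : Set X} (hB : MeasurableSet B) {A : ∀ i, Set (Y i)}
    (hA : ∀ i, MeasurableSet (A i)) :
    decouple lam ν J (B ×ˢ Set.univ.pi A) =
      lam (B ×ˢ (J : Set ι).pi A) * ∏ i ∈ Jᶜ, ν i (A i) := by
  have hpre : mixCoordinates J ⁻¹' (B ×ˢ Set.univ.pi A) =
      (B ×ˢ (J : Set ι).pi A) ×ˢ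
        Set.univ.pi (fun i => if i ∈ J then (Set.univ : Set (Y i)) else A i) := by
    ext ⟨⟨x, y⟩, z⟩
    simp only [mixCoordinates, Set.mem_preimage, Set.mem_prod, Set.mem_pi, Set.mem_univ,
      true_imp_iff, Finset.mem_coe, and_assoc]
    refine and_congr_right fun _ => ⟨fun h => ⟨fun i hi => ?_, fun i => ?_⟩, fun h i => ?_⟩
    · simpa [hi] using h i
    · by_cases hi : i ∈ J
      · simp [hi]
      · simpa [hi] using h i
    · by_cases hi : i ∈ J
      · simpa [hi] using h.1 i hi
      · simpa [hi] using h.2 i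
  rw [decouple, Measure.map_apply (measurable_mixCoordinates J)
    (hB.prod (MeasurableSet.univ_pi hA)), hpre, Measure.prod_prod, Measure.pi_pi]
  congr 1
  rw [← Finset.prod_subset (Finset.subset_univ Jᶜ)]
  · exact Finset.prod_congr rfl fun i hi => by rw [if_neg (Finset.mem_compl.1 hi)]
  · intro i _ hi
    rw [if_pos (by simpa using hi), measure_univ]

/-- The coordinate mixing map intertwines the product of `lam` with independent copies of the Sᵢ and
the original transformation, so the decoupled system is a factor of an ergodic one. -/
theorem ergodic_decouple {T : X ≃ᵐ X} {S : ∀ i, Y i ≃ᵐ Y i}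
    (hS : ∀ i, IsWeaklyMixing (ν i) (S i))
    (hlam : Ergodic (T.prodCongr (MeasurableEquiv.piCongrRight S)) lam) (J : Finset ι) :
    Ergodic (T.prodCongr (MeasurableEquiv.piCongrRight S)) (decouple lam ν J) := by
  refine MeasurePreserving.ergodic_of_ergodic_semiconj (g := mixCoordinates J)
    ⟨measurable_mixCoordinates J, rfl⟩ (ergodic_prod_pi hlam hS) (MeasurableEquiv.measurable _) ?_
  rintro ⟨⟨x, y⟩, z⟩
  refine Prod.ext rfl (funext fun i => ?_)
  change (if i ∈ J then S i (y i) else S i (z i)) = S i (if i ∈ J then y i else z i)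
  split_ifs <;> rfl

theorem integral_indicator_mul_prod_indicator (J : Finset ι) {B : Set X} (hB : MeasurableSet B)
    {A : ∀ i, Set (Y i)} (hA : ∀ i, MeasurableSet (A i)) :
    ∫ p, B.indicator (fun _ => (1 : ℝ)) p.1 * ∏ i ∈ J, (A i).indicator (fun _ => (1 : ℝ)) (p.2 i)
      ∂lam = lam.real (B ×ˢ (J : Set ι).pi A) := by
  have hm : MeasurableSet (B ×ˢ (J : Set ι).pi A) :=
    hB.prod (MeasurableSet.pi (Set.to_countable _) fun i _ => hA i)
  have heq : ∀ p : X × ∀ i, Y i, B.indicator (fun _ => (1 : ℝ)) p.1 *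
      ∏ i ∈ J, (A i).indicator (fun _ => (1 : ℝ)) (p.2 i) =
      (B ×ˢ (J : Set ι).pi A).indicator (fun _ => (1 : ℝ)) p := by
    intro p
    by_cases hp : p ∈ B ×ˢ (J : Set ι).pi A
    · rw [Set.indicator_of_mem hp, Set.indicator_of_mem hp.1, one_mul]
      exact Finset.prod_eq_one fun i hi => Set.indicator_of_mem (hp.2 i hi) _
    · rw [Set.indicator_of_notMem hp]
      by_cases hpB : p.1 ∈ B
      · have : ∃ i ∈ J, p.2 i ∉ A i := by
          by_contra! hcon
          exact hp ⟨hpB, fun i hi => hcon i hi⟩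
        obtain ⟨i, hi, hiA⟩ := this
        rw [Finset.prod_eq_zero hi (Set.indicator_of_notMem hiA _), mul_zero]
      · rw [Set.indicator_of_notMem hpB, zero_mul]
  simp_rw [heq]
  rw [integral_indicator_const _ hm, smul_eq_mul, mul_one]

/-- If products of at least `n` centered indicators are uncorrelated with the first factor, then
`lam` is an explicit linear combination of the measures `decouple lam ν J` with `|J| < n`. -/
theorem measureReal_eq_sum_decouple {n : ℕ}
    (h : ∀ B : Set X, MeasurableSet B → ∀ A : ∀ i, Set (Y i), (∀ i, MeasurableSet (A i)) →
      ∀ I : Finset ι, n ≤ I.card → ∫ p, B.indicator (fun _ => (1 : ℝ)) p.1 *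
        ∏ i ∈ I, centeredIndicator (ν i) (A i) (p.2 i) ∂lam = 0)
    {s : Set (X × ∀ i, Y i)} (hs : MeasurableSet s) :
    lam.real s = ∑ I : Finset ι with I.card < n, ∑ J ∈ I.powerset,
      (-1 : ℝ) ^ (I \ J).card * (decouple lam ν J).real s := by
  -- The coefficients have both signs, so the π-system uniqueness argument is run for signed
  -- measures.
  let κ : SignedMeasure (X × ∀ i, Y i) := ∑ I : Finset ι with I.card < n, ∑ J ∈ I.powerset,
      (-1 : ℝ) ^ (I \ J).card • (decouple lam ν J).toSignedMeasure
  have hκ : ∀ t, MeasurableSet t → κ t = ∑ I : Finset ι with I.card < n, ∑ J ∈ I.powerset,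
      (-1 : ℝ) ^ (I \ J).card * (decouple lam ν J).real t := by
    intro t ht
    let ev : SignedMeasure (X × ∀ i, Y i) →+ ℝ :=
      { toFun := fun v => v t, map_zero' := rfl, map_add' := fun _ _ => rfl }
    change ev κ = _
    simp only [κ, map_sum]
    refine Finset.sum_congr rfl fun I _ => Finset.sum_congr rfl fun J _ => ?_
    change (-1 : ℝ) ^ (I \ J).card • (decouple lam ν J).toSignedMeasure t = _
    rw [Measure.toSignedMeasure_apply_measurable ht, smul_eq_mul]
  have hbox : ∀ t ∈ measurableBoxes X Y, lam.toSignedMeasure t = κ t := by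
    rintro _ ⟨B, hB, _, ⟨A, hA, rfl⟩, rfl⟩
    have hB : MeasurableSet B := hB
    have hA : ∀ i, MeasurableSet (A i) := fun i => hA i trivial
    have hm := hB.prod (MeasurableSet.univ_pi hA)
    rw [Measure.toSignedMeasure_apply_measurable hm, hκ _ hm]
    set f : (X × ∀ i, Y i) → ℝ := fun p => B.indicator (fun _ => (1 : ℝ)) p.1
    set a : ∀ i, (X × ∀ i, Y i) → ℝ := fun i p => (A i).indicator (fun _ => (1 : ℝ)) (p.2 i)
    set g : ∀ i, (X × ∀ i, Y i) → ℝ := fun i p => centeredIndicator (ν i) (A i) (p.2 i)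
    set c : ι → ℝ := fun i => (ν i).real (A i)
    have hag : ∀ i p, a i p = g i p + c i := fun i p => by
      simp only [a, g, c, centeredIndicator]; ring
    have hfm : Measurable f := (measurable_const.indicator hB).comp measurable_fst
    have hgm : ∀ i, Measurable (g i) := fun i => (measurable_centeredIndicator (hA i)).comp
      ((measurable_pi_apply i).comp measurable_snd)
    have ham : ∀ i, Measurable (a i) := fun i => (measurable_const.indicator (hA i)).comp
      ((measurable_pi_apply i).comp measurable_snd)
    have hfb : ∀ p, |f p| ≤ 1 := fun p => by
      simp only [f]; by_cases hp : p.1 ∈ B <;> simp [hp]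
    have hint : ∀ (I : Finset ι) (b : ι → (X × ∀ i, Y i) → ℝ), (∀ i, Measurable (b i)) →
        (∀ i p, |b i p| ≤ 1) → Integrable (fun p => f p * ∏ i ∈ I, b i p) lam := by
      intro I b hbm hb
      refine Integrable.of_bound
        (hfm.mul (Finset.measurable_prod _ fun i _ => hbm i)).aestronglyMeasurable 1
        (ae_of_all _ fun p => ?_)
      rw [norm_mul, Real.norm_eq_abs, Real.norm_eq_abs, Finset.abs_prod]
      exact mul_le_one₀ (hfb p) (Finset.prod_nonneg fun _ _ => abs_nonneg _)
        (Finset.prod_le_one (fun _ _ => abs_nonneg _) fun i _ => hb i p)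
    have hintg := fun I => hint I g hgm fun i p => abs_centeredIndicator_le _ _ _
    have hinta := fun I => hint I a ham fun i p => by
      simp only [a]; by_cases hp : p.2 i ∈ A i <;> simp [hp]
    -- Expand ∏ (gᵢ + cᵢ) over the set `I` of coordinates from which the centered factor is chosen.
    have hfull : lam.real (B ×ˢ Set.univ.pi A) =
        ∑ I : Finset ι, (∫ p, f p * ∏ i ∈ I, g i p ∂lam) * ∏ i ∈ Iᶜ, c i := by
      have h1 := integral_indicator_mul_prod_indicator (lam := lam) Finset.univ hB hA
      rw [Finset.coe_univ] at h1
      rw [← h1]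
      have h2 : ∀ p, f p * ∏ i, a i p = ∑ I : Finset ι, (f p * ∏ i ∈ I, g i p) * ∏ i ∈ Iᶜ, c i := by
        intro p
        simp_rw [hag]
        rw [Finset.prod_add, Finset.mul_sum, Finset.powerset_univ]
        exact Finset.sum_congr rfl fun I _ => by
          rw [← Finset.compl_eq_univ_sdiff, mul_assoc]
      rw [integral_congr_ae (ae_of_all _ h2), integral_finsetSum _ fun I _ =>
        (hintg I).mul_const _]
      exact Finset.sum_congr rfl fun I _ => integral_mul_const _ _
    -- Expand back with gᵢ = aᵢ - cᵢ. The constants from outside `J` assemble to the masses of the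
    -- resampled sides of the box, up to the sign (-1)^|I \ J|.
    have hpart : ∀ I : Finset ι, (∫ p, f p * ∏ i ∈ I, g i p ∂lam) * ∏ i ∈ Iᶜ, c i =
        ∑ J ∈ I.powerset, (-1 : ℝ) ^ (I \ J).card *
          (decouple lam ν J).real (B ×ˢ Set.univ.pi A) := by
      intro I
      have h2 : ∀ p, f p * ∏ i ∈ I, g i p =
          ∑ J ∈ I.powerset, (f p * ∏ i ∈ J, a i p) * ∏ i ∈ I \ J, -c i := by
        intro p
        have : ∀ i, g i p = a i p + -c i := fun i => by rw [hag]; ring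
        simp_rw [this]
        rw [Finset.prod_add, Finset.mul_sum]
        exact Finset.sum_congr rfl fun J _ => by rw [mul_assoc]
      rw [integral_congr_ae (ae_of_all _ h2), integral_finsetSum _ fun J _ =>
        (hinta J).mul_const _, Finset.sum_mul]
      refine Finset.sum_congr rfl fun J hJ => ?_
      have hJI : J ⊆ I := Finset.mem_powerset.1 hJ
      rw [integral_mul_const, integral_indicator_mul_prod_indicator J hB hA, Finset.prod_neg]
      have h3 : (decouple lam ν J).real (B ×ˢ Set.univ.pi A) =
          lam.real (B ×ˢ (J : Set ι).pi A) * ∏ i ∈ Jᶜ, c i := by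
        simp only [Measure.real, c]
        rw [decouple_box J hB hA, ENNReal.toReal_mul, ENNReal.toReal_prod]
      have h4 : ∏ i ∈ Jᶜ, c i = (∏ i ∈ I \ J, c i) * ∏ i ∈ Iᶜ, c i := by
        rw [← Finset.prod_union]
        · congr 1
          ext i
          simp only [Finset.mem_compl, Finset.mem_union, Finset.mem_sdiff]
          have := @hJI i
          tauto
        · rw [Finset.disjoint_left]
          intro i hi hi'
          exact (Finset.mem_compl.1 hi') (Finset.mem_sdiff.1 hi).1
      rw [h3, h4]
      ring
    rw [hfull, ← Finset.sum_filter_add_sum_filter_not _ (fun I : Finset ι => I.card < n),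
      Finset.sum_congr rfl fun I _ => hpart I]
    conv_rhs => rw [← add_zero (Finset.sum _ _)]
    congr 1
    refine Finset.sum_eq_zero fun I hI => ?_
    rw [h B hB A hA I (not_lt.1 (Finset.mem_filter.1 hI).2), zero_mul]
  have heq : lam.toSignedMeasure = κ :=
    VectorMeasure.ext_of_generateFrom _ hbox (generateFrom_measurableBoxes Y).symm
      (isPiSystem_measurableBoxes Y) (hbox _ (univ_mem_measurableBoxes Y))
  rw [← hκ s hs, ← heq, Measure.toSignedMeasure_apply_measurable hs]

/-- A probability measure which is a linear combination of the `decouple lam ν J`, `|J| < n`, cannot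
be singular to all of them. -/
theorem exists_not_mutuallySingular_decouple {n : ℕ}
    (h : ∀ s : Set (X × ∀ i, Y i), MeasurableSet s → lam.real s =
      ∑ I : Finset ι with I.card < n, ∑ J ∈ I.powerset,
        (-1 : ℝ) ^ (I \ J).card * (decouple lam ν J).real s) :
    ∃ J : Finset ι, J.card < n ∧ ¬ lam.MutuallySingular (decouple lam ν J) := by
  by_contra! hcon
  -- Singularity to each measure gives one set null for all of them and of full `lam`-measure, on
  -- which the linear combination would be 0 instead of 1.
  have hsum : lam.MutuallySingular
      (Measure.sum fun J : {J : Finset ι // J.card < n} => decouple lam ν J) :=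
    Measure.MutuallySingular.sum_right.2 fun J => hcon J J.2
  obtain ⟨s, hs, hs0, hs1⟩ := hsum
  rw [Measure.sum_apply_eq_zero] at hs1
  have h1 : lam.real sᶜ = 1 := by
    rw [probReal_compl_eq_one_sub hs, Measure.real, hs0]; simp
  rw [h _ hs.compl, Finset.sum_eq_zero] at h1
  · exact zero_ne_one h1
  · intro I hI
    refine Finset.sum_eq_zero fun J hJ => ?_
    have hJ : J.card < n :=
      (Finset.card_le_card (Finset.mem_powerset.1 hJ)).trans_lt (Finset.mem_filter.1 hI).2
    rw [Measure.real, hs1 ⟨J, hJ⟩]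
    simp

/-- If `lam` is unchanged by decoupling the coordinates outside `J ⊆ I`, then it is the product of
its projection to the coordinates in `I` and of the `ν j`, `j ∉ I`. -/
theorem map_eq_prod_of_eq_decouple {J I : Finset ι} (hJI : J ⊆ I) (h : lam = decouple lam ν J) :
    lam.map (fun p => ((p.1, fun i : {i // i ∈ I} => p.2 i), fun j : {j // j ∉ I} => p.2 j)) =
      (lam.map fun p => (p.1, fun i : {i // i ∈ I} => p.2 i)).prod
        (Measure.pi fun j : {j // j ∉ I} => ν j) := by
  have hm1 : Measurable fun p : X × (∀ i, Y i) => (p.1, fun i : {i // i ∈ I} => p.2 i) :=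
    measurable_fst.prodMk (measurable_pi_lambda _ fun i =>
      (measurable_pi_apply _).comp measurable_snd)
  have hm2 : Measurable fun p : X × (∀ i, Y i) => fun j : {j // j ∉ I} => p.2 j :=
    measurable_pi_lambda _ fun i => (measurable_pi_apply _).comp measurable_snd
  have hprob : IsProbabilityMeasure (lam.map fun p => (p.1, fun i : {i // i ∈ I} => p.2 i)) :=
    Measure.isProbabilityMeasure_map hm1.aemeasurable
  symm
  refine Measure.prod_eq_generateFrom (generateFrom_measurableBoxes _) generateFrom_pi
    (isPiSystem_measurableBoxes _) isPiSystem_pi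
    ⟨fun _ => Set.univ, fun _ => univ_mem_measurableBoxes _, fun _ => measure_lt_top _ _,
      Set.iUnion_const _⟩
    ⟨fun _ => Set.univ, fun _ => ⟨fun _ => Set.univ, by simp, by simp⟩,
      fun _ => measure_lt_top _ _, Set.iUnion_const _⟩ ?_
  rintro _ ⟨B, hB, _, ⟨A, hA, rfl⟩, rfl⟩ _ ⟨C, hC, rfl⟩
  have hB : MeasurableSet B := hB
  have hA : ∀ i, MeasurableSet (A i) := fun i => hA i trivial
  have hC : ∀ i, MeasurableSet (C i) := fun i => hC i trivial
  -- `D` glues the sides on `I` and off `I` into one box; `E` leaves the coordinates off `I` free,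
  -- for the projection.
  let D : ∀ i, Set (Y i) := fun i => if hi : i ∈ I then A ⟨i, hi⟩ else C ⟨i, hi⟩
  let E : ∀ i, Set (Y i) := fun i => if hi : i ∈ I then A ⟨i, hi⟩ else Set.univ
  have hD : ∀ i, MeasurableSet (D i) := fun i => by
    by_cases hi : i ∈ I
    · simp only [D, hi, dif_pos]; exact hA _
    · simp only [D, hi, dif_neg, not_false_eq_true]; exact hC _
  have hE : ∀ i, MeasurableSet (E i) := fun i => by
    by_cases hi : i ∈ I
    · simp only [E, hi, dif_pos]; exact hA _
    · simp only [E, hi, dif_neg, not_false_eq_true]; exact MeasurableSet.univ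
  have hpreD : (fun p : X × (∀ i, Y i) =>
      ((p.1, fun i : {i // i ∈ I} => p.2 i), fun j : {j // j ∉ I} => p.2 j)) ⁻¹'
      ((B ×ˢ Set.univ.pi A) ×ˢ Set.univ.pi C) = B ×ˢ Set.univ.pi D := by
    ext ⟨x, y⟩
    simp only [Set.mem_preimage, Set.mem_prod, Set.mem_pi, Set.mem_univ, true_imp_iff, and_assoc,
      Subtype.forall]
    refine and_congr_right fun _ => ⟨fun h i => ?_, fun h => ⟨fun i hi => ?_, fun i hi => ?_⟩⟩
    · by_cases hi : i ∈ I
      · simpa [D, hi] using h.1 i hi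
      · simpa [D, hi] using h.2 i hi
    · simpa [D, hi] using h i
    · simpa [D, hi] using h i
  have hpreE : (fun p : X × (∀ i, Y i) => (p.1, fun i : {i // i ∈ I} => p.2 i)) ⁻¹'
      (B ×ˢ Set.univ.pi A) = B ×ˢ Set.univ.pi E := by
    ext ⟨x, y⟩
    simp only [Set.mem_preimage, Set.mem_prod, Set.mem_pi, Set.mem_univ, true_imp_iff,
      Subtype.forall]
    refine and_congr_right fun _ => ⟨fun h i => ?_, fun h i hi => ?_⟩
    · by_cases hi : i ∈ I
      · simpa [E, hi] using h i hi
      · simp [E, hi]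
    · simpa [E, hi] using h i
  change lam.map _ ((B ×ˢ Set.univ.pi A) ×ˢ Set.univ.pi C) = lam.map _ (B ×ˢ Set.univ.pi A) * _
  rw [Measure.map_apply (hm1.prodMk hm2)
      ((hB.prod (MeasurableSet.univ_pi hA)).prod (MeasurableSet.univ_pi hC)),
    Measure.map_apply hm1 (hB.prod (MeasurableSet.univ_pi hA)), hpreD, hpreE, Measure.pi_pi]
  rw [h, decouple_box J hB hD, decouple_box J hB hE, mul_assoc]
  have hpi : (J : Set ι).pi D = (J : Set ι).pi E := by
    refine Set.pi_congr rfl fun i hi => ?_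
    have : i ∈ I := hJI hi
    simp [D, E, this]
  rw [hpi]
  congr 1
  have hsub : ∏ j : {j // j ∉ I}, ν j (C j) = ∏ i ∈ Iᶜ, ν i (D i) := by
    rw [Finset.prod_subtype (p := fun j => j ∉ I) Iᶜ (fun i => Finset.mem_compl)
      (fun i => ν i (D i))]
    exact Finset.prod_congr rfl fun j _ => by simp [D, j.2]
  -- The sides agree on `I \ J`, so the two boxes differ only by the factors off `I`, which are 1
  -- for `E`.
  have hIJ : Iᶜ ⊆ Jᶜ := Finset.compl_subset_compl.2 hJI
  rw [hsub, ← Finset.prod_sdiff hIJ, ← Finset.prod_sdiff (s₂ := Jᶜ) (f := fun i => ν i (E i)) hIJ]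
  have h1 : ∏ i ∈ Iᶜ, ν i (E i) = 1 :=
    Finset.prod_eq_one fun i hi => by simp [E, Finset.mem_compl.1 hi]
  rw [h1, mul_one]
  congr 1
  refine Finset.prod_congr rfl fun i hi => ?_
  have : i ∈ I := by
    simpa using (Finset.mem_sdiff.1 hi).2
  simp [D, E, this]

end Decoupling
end

/-! ### From convolution singularity to joining primeness -/

theorem mainTheorem1 {X : Type u} [MeasurableSpace X] [StandardBorelSpace X]
    (μ : Measure X) [IsProbabilityMeasure μ] (T : X ≃ᵐ X) (hT : Ergodic T μ)
    (n : ℕ) (hn : 2 ≤ n) (hCS : HasCS n μ T hT.toMeasurePreserving) :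
    HasJP.{u, v} (n - 1) μ T := by
  intro k hk Y _ _ ν _ S hS lam hlam
  obtain ⟨hfst, hsnd, herg⟩ := hlam
  have hfst' : MeasurePreserving Prod.fst lam μ := ⟨measurable_fst, hfst⟩
  have hsnd' : MeasurePreserving Prod.snd lam (Measure.pi ν) := ⟨measurable_snd, hsnd⟩
  have hprob : IsProbabilityMeasure lam := by
    refine ⟨?_⟩
    rw [← Set.preimage_univ (f := Prod.fst),
      hfst'.measure_preimage MeasurableSet.univ.nullMeasurableSet, measure_univ]
  obtain ⟨J, hJ, hns⟩ := exists_not_mutuallySingular_decouple (lam := lam) (ν := ν) (n := n)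
    fun s hs => measureReal_eq_sum_decouple (fun B hB A hA I hI =>
      hCS.integral_indicator_mul_prod_eq_zero (by lia) hS hfst' hsnd'
        herg.toMeasurePreserving hB hA hI) hs
  have heq : lam = decouple lam ν J :=
    (herg.eq_or_mutuallySingular (ergodic_decouple hS herg J)).resolve_right hns
  -- `J` has at most n - 1 elements, and `k ≥ n` leaves room to enlarge it to exactly n - 1.
  obtain ⟨I, hJI, hI⟩ := Finset.exists_superset_card_eq (s := J) (n := n - 1) (by lia)
    (by rw [Fintype.card_fin]; lia)
  exact ⟨I, hI, map_eq_prod_of_eq_decouple hJI heq⟩
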